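/- Let $(X_k)_{k\ge 0}$ be a birth-and-death Markov chain on $\{0,1,2,\dots\}$ with transition probabilities $p_{i,i+1}=p_i$, $p_{i,i-1}=q_i$, where $p_0=1$, $q_0=0$, and $p_i,q_i>0$, $p_i+q_i=1$ for $i\ge 1$; its initial distribution is arbitrary. Let $\tau^+,\tau^-$ be positive random variables with distribution functions $F^+,F^-$, and let $a_i^\pm>0$ $(i\ge 0)$ with $a_i^\pm\to\infty$ as $i\to\infty$. Assume that $1-F^\pm$ varies regularly at $+\infty$ with exponent $-\alpha^\pm$, where $0<\alpha^\pm<1$; that is, $1-F^\pm(x)=x^{-\alpha^\pm}l^\pm(x)$ for all large $x$, with $l^\pm$ slowly varying at $+\infty$. Let $\tau_{i,k}^\pm$ $(i,k\ge 0)$ be positive random variables, independent of each other and of the chain $(X_k)$, with $\tau_{i,k}^\pm\overset{d}{=}\tau^\pm/a_i^\pm$. Put $T_0=0$ and $T_{k+1}=T_k+\tau^k$, where $\tau^k=\tau_{i,k}^{+}$ if $X_k=i$, $X_{k+1}=i+1$, and $\tau^k=\tau_{i,k}^-$ if $X_k=i$, $X_{k+1}=i-1$. The continuous-time random walk is $X(t)=X_k$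 for $t\in[T_k,T_{k+1})$. Let $\sigma_n=\inf\{t\ge 0: X(t)=n\}$ (with $\inf\emptyset=\infty$). We say that $X$ explodes if $\sigma_\infty=\lim_{n\to\infty}\sigma_n<\infty$. Put $$\delta_k=\frac{q_1\cdots q_k}{p_1\cdots p_k}\quad(k\ge 0),\qquad E=\sum_{i=0}^\infty\bigl(1-p_iF^+(a_i^+)-q_iF^-(a_i^-)\bigr)\sum_{k=i}^\infty\frac{q_{i+1}\cdots q_k}{p_i\cdots p_k},$$ $$I=\sum_{i=1}^\infty\bigl(1-p_iF^+(a_i^+)-q_iF^-(a_i^-)\bigr)\sum_{k=0}^{i-1}\frac{p_{k+1}\cdots p_{i-1}}{q_{k+1}\cdots q_i},$$ where empty products are equal to $1$ and the sums take values in $[0,\infty]$. Then: (1) For every initial distribution, $\mathsf P\{X\text{ explodes}\}=1$ if and only if $E<\infty$, and $\mathsf P\{X\text{ explodes}\}=0$ if and only if $E=\infty$. (2) Let $\mathsf P_i$ be the law of the walk under $X(0)=i$. Then $X$ implodes from infinity, in the sense that $\lim_{C\to+\infty}\sup_i\mathsf P_i(\sigma_0>C)=0$, if and only if $I<\infty$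 and $\sum_{k=0}^\infty\delta_k=\infty$. (3) Let $Y_n$ $(n\ge 0)$ be independent walks of this kind, with $Y_n(0)=n$, let $\theta_n=\inf\{t\ge 0:Y_n(t)=n-1\}$ for $n\ge 1$, and let $\rho_\infty=\sum_{n=1}^\infty\theta_n$ (the time of hitting $0$ when starting at infinity). Then $\mathsf P\{\rho_\infty<\infty\}=1$ if and only if $I<\infty$ and $\sum_{k=0}^\infty\delta_k=\infty$; and $\mathsf P\{\rho_\infty<\infty\}=0$ if and only if $I=\infty$ or $\sum_{k=0}^\infty\delta_k<\infty$. -/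

import Mathlib

open MeasureTheory ProbabilityTheory Filter Topology
open scoped ENNReal NNReal

noncomputable section

/-- `l` is slowly varying at `+∞`: it is positive and measurable on some half-line `[A, ∞)`
and `l (c x) / l x → 1` as `x → +∞`, for every `c > 0`. -/
def SlowlyVarying (l : ℝ → ℝ) : Prop :=
  (∃ A : ℝ, (∀ x, A ≤ x → 0 < l x) ∧ Measurable (fun x : Set.Ici A => l x)) ∧
    ∀ c : ℝ, 0 < c → Tendsto (fun x => l (c * x) / l x) atTop (𝓝 1)

/-- `f` varies regularly at `+∞` with exponent `ρ`: `f x = x ^ ρ * l x` for all large `x`,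
with `l` slowly varying at `+∞`. -/
def RegularlyVarying (f : ℝ → ℝ) (ρ : ℝ) : Prop :=
  ∃ l : ℝ → ℝ, SlowlyVarying l ∧ ∀ᶠ x in atTop, f x = x ^ ρ * l x

/-- The direction of a jump: to the right (`+`) or to the left (`-`). -/
inductive Dir
  | right
  | left

/-- The one-step transition probabilities of the birth-and-death chain on `{0, 1, 2, …}`. -/
def transProb (p q : ℕ → ℝ) (i j : ℕ) : ℝ :=
  if j = i + 1 then p i else if j + 1 = i then q i else 0

/-- The random ingredients of a continuous-time random walk: the embedded chain `X k`, and the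
waiting times `τ i s k` (`i` is the state, `s` the direction of the jump, `k` the number
of the copy). -/
structure WalkData (Ω : Type*) where
  X : ℕ → Ω → ℕ
  τ : ℕ → Dir → ℕ → Ω → ℝ

namespace WalkData

variable {Ω : Type*}

/-- The `k`-th waiting time: `τ⁺_{i,k}` if `X_k = i` and the chain then jumps to `i + 1`, and
`τ⁻_{i,k}` if `X_k = i` and it jumps to `i - 1`. -/
def wait (D : WalkData Ω) (k : ℕ) (ω : Ω) : ℝ :=
  if D.X (k + 1) ω = D.X k ω + 1 then D.τ (D.X k ω) Dir.right k ω
  else D.τ (D.X k ω) Dir.left k ω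

/-- The jump moments: `T_0 = 0` and `T_{k+1} = T_k + τ^k`. -/
def T (D : WalkData Ω) : ℕ → Ω → ℝ
  | 0, _ => 0
  | k + 1, ω => D.T k ω + D.wait k ω

open Classical in
/-- The continuous-time random walk: its value at time `t` is `X_k` if `t ∈ [T_k, T_{k+1})`
(as the waiting times are positive, `k` is then unique), and `∞` if there is no such `k`,
that is, if `t` is not smaller than `lim T_k`. -/
def walk (D : WalkData Ω) (t : ℝ≥0) (ω : Ω) : ℕ∞ :=
  if h : ∃ k, D.T k ω ≤ t ∧ t < D.T (k + 1) ω then ((D.X (Nat.find h) ω : ℕ) : ℕ∞) else ⊤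

/-- `σ_n = inf {t ≥ 0 | X(t) = n}`, with `inf ∅ = ∞`. -/
def hitTime (D : WalkData Ω) (n : ℕ) (ω : Ω) : ℝ≥0∞ :=
  ⨅ (t : ℝ≥0) (_ : D.walk t ω = (n : ℕ∞)), (t : ℝ≥0∞)

/-- The walk explodes: `σ_∞ = lim σ_n` is finite. -/
def Explodes (D : WalkData Ω) (ω : Ω) : Prop :=
  ∃ s : ℝ≥0∞, s < ⊤ ∧ Tendsto (fun n => D.hitTime n ω) atTop (𝓝 s)

/-- `D` is a continuous-time random walk on the probability space `(Ω, μ)`, with some initial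
distribution, such that the embedded chain has transition probabilities `p`, `q` and the waiting
times in state `i` and direction `s` have distribution `W i s`. -/
structure IsWalk (p q : ℕ → ℝ) (W : ℕ → Dir → Measure ℝ) [MeasurableSpace Ω] (μ : Measure Ω)
    (D : WalkData Ω) : Prop where
  measurable_X : ∀ k, Measurable (D.X k)
  measurable_τ : ∀ i s k, Measurable (D.τ i s k)
  /-- the Markov property of the embedded chain -/
  markov : ∀ (n : ℕ) (x : ℕ → ℕ),
    μ {ω | ∀ k ≤ n + 1, D.X k ω = x k} =
      μ {ω | ∀ k ≤ n, D.X k ω = x k} * ENNReal.ofReal (transProb p q (x n) (x (n + 1)))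
  pos : ∀ i s k ω, 0 < D.τ i s k ω
  law : ∀ i s k, μ.map (D.τ i s k) = W i s
  /-- all the waiting times are independent -/
  indep_τ : iIndepFun (fun (j : ℕ × Dir × ℕ) (ω : Ω) => D.τ j.1 j.2.1 j.2.2 ω) μ
  /-- the chain is independent of the waiting times -/
  indep_X_τ : IndepFun (fun (ω : Ω) (k : ℕ) => D.X k ω)
    (fun (ω : Ω) (j : ℕ × Dir × ℕ) => D.τ j.1 j.2.1 j.2.2 ω) μ

/-- `D` is a continuous-time random walk as above that starts at the state `i`. -/
def IsWalkFrom (p q : ℕ → ℝ) (W : ℕ → Dir → Measure ℝ) [MeasurableSpace Ω] (μ : Measure Ω)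
    (i : ℕ) (D : WalkData Ω) : Prop :=
  D.IsWalk p q W μ ∧ ∀ᵐ ω ∂μ, D.X 0 ω = i

end WalkData

/-- `ρ_∞ = ∑_{n ≥ 1} θ_n`, where `θ_n = inf {t ≥ 0 | Y_n(t) = n - 1}`. -/
def implosionTime {Ω : Type*} (Y : ℕ → WalkData Ω) (ω : Ω) : ℝ≥0∞ :=
  ∑' n : ℕ, (Y (n + 1)).hitTime n ω

/-- `δ_k = (q_1 ⋯ q_k) / (p_1 ⋯ p_k)`. -/
def delta (p q : ℕ → ℝ) (k : ℕ) : ℝ :=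
  (∏ j ∈ Finset.Icc 1 k, q j) / ∏ j ∈ Finset.Icc 1 k, p j

/-- `1 - p_i F⁺(a⁺_i) - q_i F⁻(a⁻_i)`, where `F^±` is the distribution function of `L^±`. -/
def meanTail (p q : ℕ → ℝ) (L : Dir → Measure ℝ) (a : Dir → ℕ → ℝ) (i : ℕ) : ℝ :=
  1 - p i * cdf (L Dir.right) (a Dir.right i) - q i * cdf (L Dir.left) (a Dir.left i)

/-- `∑_{i ≥ 0} (1 - p_i F⁺(a⁺_i) - q_i F⁻(a⁻_i)) ∑_{k ≥ i} (q_{i+1} ⋯ q_k) / (p_i ⋯ p_k)`,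
as an element of `[0, ∞]`. -/
def explosionSeries (p q : ℕ → ℝ) (L : Dir → Measure ℝ) (a : Dir → ℕ → ℝ) : ℝ≥0∞ :=
  ∑' i : ℕ, ENNReal.ofReal (meanTail p q L a i) *
    ∑' k : Set.Ici i,
      ENNReal.ofReal ((∏ j ∈ Finset.Ioc i (k : ℕ), q j) / ∏ j ∈ Finset.Icc i (k : ℕ), p j)

/-- `∑_{i ≥ 1} (1 - p_i F⁺(a⁺_i) - q_i F⁻(a⁻_i)) ∑_{k=0}^{i-1} (p_{k+1} ⋯ p_{i-1}) / (q_{k+1} ⋯ q_i)`,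
as an element of `[0, ∞]`. -/
def implosionSeries (p q : ℕ → ℝ) (L : Dir → Measure ℝ) (a : Dir → ℕ → ℝ) : ℝ≥0∞ :=
  ∑' i : Set.Ici 1, ENNReal.ofReal (meanTail p q L a i) *
    ∑ k ∈ Finset.range (i : ℕ),
      ENNReal.ofReal ((∏ j ∈ Finset.Ioo k (i : ℕ), p j) / ∏ j ∈ Finset.Ioc k (i : ℕ), q j)

/-- `∑_{k ≥ 0} δ_k`, as an element of `[0, ∞]`. -/
def deltaSeries (p q : ℕ → ℝ) : ℝ≥0∞ :=
  ∑' k : ℕ, ENNReal.ofReal (delta p q k)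

end

/-! The waiting times have infinite mean, so they are measured by the truncated mean c_i = E min(τ,
1), where τ is the waiting time in state i. Because α^± < 1, E min(τ^±/a, 1) lies between 1 - F^±(a)
and a constant multiple of it (`tail_le_lintegral_min`, `exists_lintegral_min_le`), so c_i is
comparable with m_i = 1 - p_i F⁺(a_i⁺) - q_i F⁻(a_i⁻). The inner factors in E and I are Green
kernels: E sums over n the mean of the additive functional Σ m(X_k) on the passage from n to n + 1,
and I does the same for the passages from k + 1 to k (`explosionSeries_eq`, `implosionSeries_eq`).

Convergence gives finite times. Tail sums of the upward means and partial sums of the downward means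
are superharmonic with drift c, so the supermartingale inequality bounds the expectation of Σ
min(τ^k, 1) along the path. Finitely many terms exceed 1, hence Σ τ^k is finite too. As c > 0, every
state is visited finitely often before the target is reached. For explosion this means escape to
infinity. For implosion, Σ δ_k = ∞ provides a superharmonic function growing to infinity, which
forbids escape, so the target is hit. The bounds do not depend on the starting point.

Divergence gives infinite times, through Laplace transforms. Each factor f = E exp(-τ^±/a) is at
most 1 - γ (1 - F^±(a)) with γ = 1 - 1/e (`exists_laplace`). A positive u with p_i f⁺_i u_{i+1} +
q_i f⁻_i u_{i-1} ≤ u_i yields E_i exp(-σ_n) ≤ u_i / u_n. The increasing solution tends to infinity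
if E = ∞, which excludes explosion. The decreasing solution tends to 0 if I = ∞, and the tail sums
of δ do so if Σ δ_k < ∞. Then E_i exp(-σ_0) → 0 excludes implosion, and independence turns a
telescoping product of such bounds into E exp(-ρ_∞) = 0. -/

/-! ### Integrals along paths of the embedded chain, and the Markov step. -/

/-- The direction of a jump from `i` to `j`. -/
def jumpDir (i j : ℕ) : Dir := if j = i + 1 then Dir.right else Dir.left

theorem lintegral_eq_tsum_fiber {Ω ι : Type*} [MeasurableSpace Ω] {μ : Measure Ω} [Countable ι]
    {A : Set Ω} {R : Ω → ι} (hR : ∀ y, MeasurableSet (A ∩ R ⁻¹' {y})) (f : Ω → ℝ≥0∞) :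
    ∫⁻ ω in A, f ω ∂μ = ∑' y, ∫⁻ ω in A ∩ R ⁻¹' {y}, f ω ∂μ := by
  rw [← lintegral_iUnion hR]
  · congr 2
    rw [← Set.inter_iUnion, ← Set.preimage_iUnion, Set.iUnion_of_singleton, Set.preimage_univ,
      Set.inter_univ]
  · intro y z hyz
    refine Set.disjoint_left.2 fun ω h h' => hyz ?_
    exact h.2.symm.trans h'.2

namespace WalkData

variable {Ω : Type*}

theorem wait_eq (D : WalkData Ω) (k : ℕ) (ω : Ω) :
    D.wait k ω = D.τ (D.X k ω) (jumpDir (D.X k ω) (D.X (k + 1) ω)) k ω := by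
  unfold wait jumpDir
  split_ifs <;> rfl

/-- The event that the first `k + 1` states of the chain are `x 0, …, x k`. -/
def pathEvent (D : WalkData Ω) (k : ℕ) (x : ℕ → ℕ) : Set Ω := {ω | ∀ j ≤ k, D.X j ω = x j}

/-- The product of a functional of the state and of the waiting time over the first `k` jumps. -/
noncomputable def weight (D : WalkData Ω) (G : ℕ → ℝ → ℝ≥0∞) (k : ℕ) (ω : Ω) : ℝ≥0∞ :=
  ∏ j ∈ Finset.range k, G (D.X j ω) (D.wait j ω)

theorem weight_of_mem (D : WalkData Ω) {G : ℕ → ℝ → ℝ≥0∞} {k : ℕ} {x : ℕ → ℕ} {ω : Ω}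
    (h : ω ∈ D.pathEvent k x) :
    D.weight G k ω = ∏ j ∈ Finset.range k,
      G (x j) (D.τ (x j) (jumpDir (x j) (x (j + 1))) j ω) := by
  refine Finset.prod_congr rfl fun j hj => ?_
  have hj := Finset.mem_range.1 hj
  rw [wait_eq, h j hj.le, h (j + 1) hj]

section

variable [MeasurableSpace Ω] {p q : ℕ → ℝ} {W : ℕ → Dir → Measure ℝ} {μ : Measure Ω}
  {D : WalkData Ω}

theorem IsWalk.measurableSet_pathEvent (hD : D.IsWalk p q W μ) (k : ℕ) (x : ℕ → ℕ) :
    MeasurableSet (D.pathEvent k x) := by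
  have : D.pathEvent k x = ⋂ j, ⋂ (_ : j ≤ k), D.X j ⁻¹' {x j} := by
    ext ω; simp [pathEvent]
  rw [this]
  exact MeasurableSet.iInter fun j => MeasurableSet.iInter fun _ =>
    hD.measurable_X j (measurableSet_singleton _)

theorem IsWalk.measurable_wait (hD : D.IsWalk p q W μ) (k : ℕ) : Measurable (D.wait k) := by
  have h : D.wait k = fun ω => (fun z : ℕ × ℕ => fun ω => D.τ z.1 (jumpDir z.1 z.2) k ω)
      (D.X k ω, D.X (k + 1) ω) ω := by
    ext ω; exact D.wait_eq k ω
  rw [h]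
  have h2 : Measurable (Function.uncurry
      (fun z : ℕ × ℕ => fun ω => D.τ z.1 (jumpDir z.1 z.2) k ω)) :=
    measurable_from_prod_countable_right fun z => hD.measurable_τ z.1 (jumpDir z.1 z.2) k
  exact h2.comp (((hD.measurable_X k).prodMk (hD.measurable_X (k + 1))).prodMk measurable_id)

theorem IsWalk.measurable_comp (hD : D.IsWalk p q W μ) {ψ : ℕ → ℕ → ℝ → ℝ≥0∞}
    (hψ : ∀ i j, Measurable (ψ i j)) (k : ℕ) :
    Measurable fun ω => ψ (D.X k ω) (D.X (k + 1) ω) (D.wait k ω) := by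
  have h2 : Measurable (Function.uncurry (fun z : ℕ × ℕ => fun t : ℝ => ψ z.1 z.2 t)) :=
    measurable_from_prod_countable_right fun z => hψ z.1 z.2
  exact h2.comp (((hD.measurable_X k).prodMk (hD.measurable_X (k + 1))).prodMk
    (hD.measurable_wait k))

theorem IsWalk.measurable_comp_X (hD : D.IsWalk p q W μ) (f : ℕ → ℝ≥0∞) (k : ℕ) :
    Measurable fun ω => f (D.X k ω) :=
  (measurable_of_countable f).comp (hD.measurable_X k)

theorem IsWalk.measurable_weight (hD : D.IsWalk p q W μ) {G : ℕ → ℝ → ℝ≥0∞}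
    (hG : ∀ i, Measurable (G i)) (k : ℕ) : Measurable (D.weight G k) := by
  unfold weight
  exact Finset.measurable_fun_prod _ fun j _ =>
    hD.measurable_comp (ψ := fun i _ => G i) (fun i _ => hG i) j

/-- Once the path is frozen, the waiting times involved have deterministic indices. They are
independent of the chain and of each other, so the integral factorizes. -/
theorem IsWalk.lintegral_path (hD : D.IsWalk p q W μ) (x : ℕ → ℕ) (k m : ℕ)
    {g : ℕ → ℝ → ℝ≥0∞} (hg : ∀ j, Measurable (g j)) :
    ∫⁻ ω in D.pathEvent k x, ∏ j ∈ Finset.range m,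
        g j (D.τ (x j) (jumpDir (x j) (x (j + 1))) j ω) ∂μ =
      μ (D.pathEvent k x) * ∏ j ∈ Finset.range m,
        ∫⁻ t, g j t ∂(W (x j) (jumpDir (x j) (x (j + 1)))) := by
  have hms := hD.measurableSet_pathEvent k x
  have hmS : MeasurableSet {y : ℕ → ℕ | ∀ j ≤ k, y j = x j} := by
    have : {y : ℕ → ℕ | ∀ j ≤ k, y j = x j} =
        ⋂ j, ⋂ (_ : j ≤ k), (fun y : ℕ → ℕ => y j) ⁻¹' {x j} := by
      ext ω; simp
    rw [this]
    exact MeasurableSet.iInter fun j => MeasurableSet.iInter fun _ =>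
      measurable_pi_apply j (measurableSet_singleton _)
  have hmF : Measurable fun z : ℕ × Dir × ℕ → ℝ => ∏ j ∈ Finset.range m,
      g j (z (x j, jumpDir (x j) (x (j + 1)), j)) :=
    Finset.measurable_fun_prod _ fun j _ => (hg j).comp (measurable_pi_apply _)
  have hmφ : Measurable ({y : ℕ → ℕ | ∀ j ≤ k, y j = x j}.indicator (fun _ => (1 : ℝ≥0∞))) :=
    measurable_const.indicator hmS
  have hind := hD.indep_X_τ.comp hmφ hmF
  have hmX : Measurable (fun (ω : Ω) (k : ℕ) => D.X k ω) := measurable_pi_lambda _ hD.measurable_X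
  have hmτ : Measurable (fun (ω : Ω) (j : ℕ × Dir × ℕ) => D.τ j.1 j.2.1 j.2.2 ω) :=
    measurable_pi_lambda _ fun j => hD.measurable_τ _ _ _
  have h1 := lintegral_mul_eq_lintegral_mul_lintegral_of_indepFun
    (hmφ.comp hmX) (hmF.comp hmτ) hind
  have h2 : ∫⁻ ω, ∏ j ∈ Finset.range m,
        g j (D.τ (x j) (jumpDir (x j) (x (j + 1))) j ω) ∂μ = ∏ j ∈ Finset.range m,
        ∫⁻ t, g j t ∂(W (x j) (jumpDir (x j) (x (j + 1)))) := by
    -- The copy number `j` alone makes these indices distinct, even when the path revisits a state.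
    have hi := (hD.indep_τ.precomp (g := fun j : ℕ => (x j, jumpDir (x j) (x (j + 1)), j))
      (fun a b h => (Prod.ext_iff.1 (Prod.ext_iff.1 h).2).2)).comp g hg
    refine (lintegral_prod_eq_prod_lintegral_of_indepFun (Finset.range m) _ hi
      (fun j => (hg j).comp (hD.measurable_τ _ _ _))).trans ?_
    refine Finset.prod_congr rfl fun j _ => ?_
    rw [← hD.law _ _ j, lintegral_map (hg j) (hD.measurable_τ _ _ _)]
    rfl
  have e1 : ∀ ω, ({y : ℕ → ℕ | ∀ j ≤ k, y j = x j}.indicator (fun _ => (1 : ℝ≥0∞)) ∘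
      (fun (ω : Ω) (k : ℕ) => D.X k ω)) ω = (D.pathEvent k x).indicator (fun _ => 1) ω := by
    intro ω; rfl
  rw [← h2, ← lintegral_indicator hms]
  have h3 : ∫⁻ ω, (D.pathEvent k x).indicator (fun _ => 1) ω ∂μ = μ (D.pathEvent k x) := by
    rw [lintegral_indicator hms]; simp
  rw [← h3]
  refine Eq.trans ?_ h1
  refine lintegral_congr fun ω => ?_
  simp only [Pi.mul_apply, e1]
  by_cases h : ω ∈ D.pathEvent k x <;> simp [h]

theorem IsWalk.lintegral_weight_path (hD : D.IsWalk p q W μ) (x : ℕ → ℕ) (k : ℕ)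
    (h₀ c : ℕ → ℝ≥0∞) {G : ℕ → ℝ → ℝ≥0∞} (hG : ∀ i, Measurable (G i)) :
    ∫⁻ ω in D.pathEvent k x, h₀ (D.X 0 ω) * D.weight G k ω * c (D.X k ω) ∂μ =
      h₀ (x 0) * c (x k) * (μ (D.pathEvent k x) * ∏ j ∈ Finset.range k,
        ∫⁻ t, G (x j) t ∂(W (x j) (jumpDir (x j) (x (j + 1))))) := by
  rw [← hD.lintegral_path x k k (fun j => hG (x j)), ← lintegral_const_mul]
  · refine setLIntegral_congr_fun (hD.measurableSet_pathEvent k x) fun ω hω => ?_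
    simp only [D.weight_of_mem hω, hω 0 (Nat.zero_le _), hω k le_rfl]
    ring
  · exact Finset.measurable_fun_prod _ fun j _ => (hG _).comp (hD.measurable_τ _ _ _)

theorem IsWalk.lintegral_weight_path_succ (hD : D.IsWalk p q W μ) (x : ℕ → ℕ) (k : ℕ)
    (h₀ : ℕ → ℝ≥0∞) {G : ℕ → ℝ → ℝ≥0∞} (hG : ∀ i, Measurable (G i))
    {ψ : ℕ → ℕ → ℝ → ℝ≥0∞} (hψ : ∀ i j, Measurable (ψ i j)) :
    ∫⁻ ω in D.pathEvent (k + 1) x, h₀ (D.X 0 ω) * D.weight G k ω *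
        ψ (D.X k ω) (D.X (k + 1) ω) (D.wait k ω) ∂μ =
      h₀ (x 0) * (μ (D.pathEvent k x) * ∏ j ∈ Finset.range k,
        ∫⁻ t, G (x j) t ∂(W (x j) (jumpDir (x j) (x (j + 1))))) *
      (ENNReal.ofReal (transProb p q (x k) (x (k + 1))) *
        ∫⁻ t, ψ (x k) (x (k + 1)) t ∂(W (x k) (jumpDir (x k) (x (k + 1))))) := by
  -- The last jump carries `ψ`, the earlier ones `G`, so a single product formula covers both.
  set g : ℕ → ℝ → ℝ≥0∞ := fun j => if j = k then ψ (x k) (x (k + 1)) else G (x j) with hg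
  have hgm : ∀ j, Measurable (g j) := by
    intro j; simp only [hg]; split_ifs
    exacts [hψ _ _, hG _]
  have hgk : g k = ψ (x k) (x (k + 1)) := by simp [hg]
  have hgj : ∀ j ∈ Finset.range k, g j = G (x j) := by
    intro j hj; simp [hg, (Finset.mem_range.1 hj).ne]
  have key := hD.lintegral_path x (k + 1) (k + 1) hgm
  have hmar := hD.markov k x
  change μ (D.pathEvent (k + 1) x) = μ (D.pathEvent k x) * _ at hmar
  rw [hmar, Finset.prod_range_succ, hgk,
    Finset.prod_congr rfl (fun j hj => by rw [hgj j hj])] at key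
  have : ∀ a b c d e : ℝ≥0∞, a * (b * c) * (d * e) = a * (b * d * (c * e)) := by
    intros; ring
  rw [this, ← key, ← lintegral_const_mul]
  · refine setLIntegral_congr_fun (hD.measurableSet_pathEvent _ x) fun ω hω => ?_
    have hω' : ω ∈ D.pathEvent k x := fun j hj => hω j (hj.trans (Nat.le_succ k))
    simp only [D.weight_of_mem hω', hω 0 (Nat.zero_le _), hω' k le_rfl, hω (k + 1) le_rfl,
      Finset.prod_range_succ, hgk, D.wait_eq k]
    have : ∏ j ∈ Finset.range k, g j (D.τ (x j) (jumpDir (x j) (x (j + 1))) j ω) =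
        ∏ j ∈ Finset.range k, G (x j) (D.τ (x j) (jumpDir (x j) (x (j + 1))) j ω) :=
      Finset.prod_congr rfl fun j hj => by rw [hgj j hj]
    rw [this]
    ring
  · exact Finset.measurable_fun_prod _ fun j _ => (hgm _).comp (hD.measurable_τ _ _ _)

/-- The first `k + 1` states take countably many values, so their path events form a countable
partition. -/
theorem IsWalk.lintegral_congr_of_path (hD : D.IsWalk p q W μ) (k : ℕ) {f g : Ω → ℝ≥0∞}
    (h : ∀ x, ∫⁻ ω in D.pathEvent k x, f ω ∂μ = ∫⁻ ω in D.pathEvent k x, g ω ∂μ) :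
    ∫⁻ ω, f ω ∂μ = ∫⁻ ω, g ω ∂μ := by
  let R : Ω → (Fin (k + 1) → ℕ) := fun ω m => D.X m ω
  have hR : ∀ y : Fin (k + 1) → ℕ, ∃ x : ℕ → ℕ, Set.univ ∩ R ⁻¹' {y} = D.pathEvent k x := by
    intro y
    refine ⟨fun m => if hm : m < k + 1 then y ⟨m, hm⟩ else 0, ?_⟩
    ext ω
    simp only [Set.univ_inter, Set.mem_preimage, Set.mem_singleton_iff, pathEvent,
      Set.mem_ofPred_eq, R, funext_iff]
    constructor
    · intro h j hj
      rw [dif_pos (Nat.lt_succ_of_le hj)]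
      exact h ⟨j, Nat.lt_succ_of_le hj⟩
    · intro h j
      have := h j (Nat.le_of_lt_succ j.2)
      rwa [dif_pos j.2] at this
  have hm : ∀ y, MeasurableSet (Set.univ ∩ R ⁻¹' {y}) := by
    intro y
    obtain ⟨x, hx⟩ := hR y
    rw [hx]; exact hD.measurableSet_pathEvent k x
  rw [← setLIntegral_univ, ← setLIntegral_univ g, lintegral_eq_tsum_fiber hm,
    lintegral_eq_tsum_fiber hm]
  refine tsum_congr fun y => ?_
  obtain ⟨x, hx⟩ := hR y
  rw [hx]; exact h x

/-- The Markov property of the walk, one step after the `k`-th jump. -/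
theorem IsWalk.lintegral_step (hD : D.IsWalk p q W μ) (k : ℕ)
    (h₀ : ℕ → ℝ≥0∞) {G : ℕ → ℝ → ℝ≥0∞} (hG : ∀ i, Measurable (G i))
    {ψ : ℕ → ℕ → ℝ → ℝ≥0∞} (hψ : ∀ i j, Measurable (ψ i j)) :
    ∫⁻ ω, h₀ (D.X 0 ω) * D.weight G k ω * ψ (D.X k ω) (D.X (k + 1) ω) (D.wait k ω) ∂μ =
      ∫⁻ ω, h₀ (D.X 0 ω) * D.weight G k ω *
        (∑' j, ENNReal.ofReal (transProb p q (D.X k ω) j) *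
          ∫⁻ t, ψ (D.X k ω) j t ∂(W (D.X k ω) (jumpDir (D.X k ω) j))) ∂μ := by
  refine hD.lintegral_congr_of_path k fun x => ?_
  rw [hD.lintegral_weight_path x k h₀ (fun i => ∑' j, ENNReal.ofReal (transProb p q i j) *
          ∫⁻ t, ψ i j t ∂(W i (jumpDir i j))) hG]
  -- Splitting according to the next state turns the integral into a sum over one-step extensions of
  -- the path.
  have hupd : ∀ j, D.pathEvent k x ∩ D.X (k + 1) ⁻¹' {j} =
      D.pathEvent (k + 1) (Function.update x (k + 1) j) := by
    intro j; ext ω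
    simp only [pathEvent, Set.mem_inter_iff, Set.mem_ofPred_eq, Set.mem_preimage,
      Set.mem_singleton_iff]
    constructor
    · rintro ⟨h1, h2⟩ m hm
      rcases Nat.le_succ_iff.1 hm with hm | rfl
      · rw [Function.update_of_ne (by omega)]; exact h1 m hm
      · rw [Function.update_self, h2]
    · intro h
      refine ⟨fun m hm => ?_, ?_⟩
      · have := h m (by omega)
        rwa [Function.update_of_ne (by omega)] at this
      · have := h (k + 1) le_rfl
        rwa [Function.update_self] at this
  have hu : ∀ j, ∀ m ≤ k, Function.update x (k + 1) j m = x m := fun j m hm =>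
    Function.update_of_ne (by omega) _ _
  rw [lintegral_eq_tsum_fiber (R := D.X (k + 1))
    (fun j => by rw [hupd]; exact hD.measurableSet_pathEvent _ _)]
  have hterm : ∀ j, ∫⁻ ω in D.pathEvent k x ∩ D.X (k + 1) ⁻¹' {j},
      h₀ (D.X 0 ω) * D.weight G k ω * ψ (D.X k ω) (D.X (k + 1) ω) (D.wait k ω) ∂μ =
      (h₀ (x 0) * (μ (D.pathEvent k x) * ∏ j ∈ Finset.range k,
        ∫⁻ t, G (x j) t ∂(W (x j) (jumpDir (x j) (x (j + 1)))))) *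
      (ENNReal.ofReal (transProb p q (x k) j) *
        ∫⁻ t, ψ (x k) j t ∂(W (x k) (jumpDir (x k) j))) := by
    intro j
    rw [hupd, hD.lintegral_weight_path_succ _ k h₀ hG hψ, hu j 0 (Nat.zero_le _),
      hu j k le_rfl, Function.update_self]
    congr 3
    · congr 1
      ext ω
      simp only [pathEvent, Set.mem_ofPred_eq]
      exact forall₂_congr fun m hm => by rw [hu j m hm]
    · refine Finset.prod_congr rfl fun m hm => ?_
      have := Finset.mem_range.1 hm
      rw [hu j m (by omega), hu j (m + 1) (by omega)]
  simp_rw [hterm]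
  rw [ENNReal.tsum_mul_left]
  ring

end

end WalkData

/-! ### The exponential on `[0, ∞]` and sums over one transition. -/

/-- `exp (-t)` for `t ∈ [0, ∞]`. -/
noncomputable def expNeg (t : ℝ≥0∞) : ℝ≥0∞ := EReal.exp (-(t : EReal))

theorem expNeg_top : expNeg ⊤ = 0 := by simp [expNeg]

theorem expNeg_ofReal {x : ℝ} (hx : 0 ≤ x) :
    expNeg (ENNReal.ofReal x) = ENNReal.ofReal (Real.exp (-x)) := by
  rw [expNeg, EReal.coe_ennreal_ofReal, max_eq_left hx, ← EReal.coe_neg, EReal.exp_coe]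

theorem expNeg_antitone : Antitone expNeg := fun _ _ h =>
  EReal.exp_monotone (EReal.neg_le_neg_iff.2 (EReal.coe_ennreal_le_coe_ennreal_iff.2 h))

theorem expNeg_pos {t : ℝ≥0∞} (ht : t ≠ ⊤) : 0 < expNeg t := by
  lift t to ℝ≥0 using ht
  have e : (t : ℝ≥0∞) = ENNReal.ofReal (t : ℝ) := ENNReal.ofReal_coe_nnreal.symm
  rw [e, expNeg_ofReal t.coe_nonneg]
  exact ENNReal.ofReal_pos.2 (Real.exp_pos _)

theorem measurable_expNeg : Measurable expNeg := expNeg_antitone.measurable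

/-- At `i = 0` the truncated subtraction gives `i - 1 = 0`, and `q 0 = 0` removes that term. -/
theorem tsum_transProb {p q : ℕ → ℝ} (hq0 : q 0 = 0) (i : ℕ) (F : ℕ → ℝ≥0∞) :
    ∑' j, ENNReal.ofReal (transProb p q i j) * F j =
      ENNReal.ofReal (p i) * F (i + 1) + ENNReal.ofReal (q i) * F (i - 1) := by
  rcases i with _ | i
  · rw [tsum_eq_single 1]
    · simp [transProb, hq0]
    · intro j hj; simp [transProb, hj]
  · rw [tsum_eq_sum (s := {i + 1 + 1, i})]
    · rw [Finset.sum_pair (by omega)]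
      have : i ≠ i + 1 + 1 := by omega
      simp [transProb, this]
    · intro j hj
      simp only [Finset.mem_insert, Finset.mem_singleton, not_or] at hj
      simp [transProb, hj.1, hj.2]

theorem jumpDir_succ (i : ℕ) : jumpDir i (i + 1) = Dir.right := by simp [jumpDir]

theorem jumpDir_pred (i : ℕ) : jumpDir i (i - 1) = Dir.left := by
  rw [jumpDir, if_neg (by omega)]

/-! ### Hitting times in terms of the jump moments. -/

namespace WalkData

variable {Ω : Type*}

theorem T_eq_sum (D : WalkData Ω) (k : ℕ) (ω : Ω) :
    D.T k ω = ∑ j ∈ Finset.range k, D.wait j ω := by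
  induction k with
  | zero => rfl
  | succ k ih => rw [Finset.sum_range_succ, ← ih]; rfl

section Pathwise

variable {D : WalkData Ω} {ω : Ω}

theorem T_strictMono (h : ∀ k, 0 < D.wait k ω) : StrictMono fun k => D.T k ω :=
  strictMono_nat_of_lt_succ fun k => lt_add_of_pos_right _ (h k)

theorem T_nonneg (h : ∀ k, 0 < D.wait k ω) (k : ℕ) : 0 ≤ D.T k ω :=
  (T_strictMono h).monotone (Nat.zero_le k)

theorem walk_eq_coe_iff (h : ∀ k, 0 < D.wait k ω) {t : ℝ≥0} {n : ℕ} :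
    D.walk t ω = (n : ℕ∞) ↔ ∃ k, (D.T k ω ≤ t ∧ t < D.T (k + 1) ω) ∧ D.X k ω = n := by
  classical
  unfold walk
  split_ifs with hk
  · have hs := Nat.find_spec hk
    constructor
    · intro e; exact ⟨_, hs, by exact_mod_cast e⟩
    · rintro ⟨k, h1, rfl⟩
      have : Nat.find hk = k := by
        have a := (T_strictMono h).lt_iff_lt.1 (hs.1.trans_lt h1.2)
        have b := (T_strictMono h).lt_iff_lt.1 (h1.1.trans_lt hs.2)
        omega
      rw [this]
  · constructor
    · intro e; exact absurd e.symm (ENat.natCast_ne_top n)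
    · rintro ⟨k, h1, -⟩; exact absurd ⟨k, h1⟩ hk

theorem hitTime_eq_iInf (h : ∀ k, 0 < D.wait k ω) (n : ℕ) :
    D.hitTime n ω = ⨅ (k : ℕ) (_ : D.X k ω = n), ENNReal.ofReal (D.T k ω) := by
  apply le_antisymm
  · refine le_iInf₂ fun k hk => ?_
    refine iInf₂_le (D.T k ω).toNNReal ((walk_eq_coe_iff h).2 ⟨k, ⟨?_, ?_⟩, hk⟩)
    · exact Real.le_coe_toNNReal _
    · rw [Real.coe_toNNReal _ (T_nonneg h k)]
      exact T_strictMono h (Nat.lt_succ_self k)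
  · refine le_iInf₂ fun t ht => ?_
    obtain ⟨k, h1, hk⟩ := (walk_eq_coe_iff h).1 ht
    refine (iInf₂_le k hk).trans ?_
    rw [← ENNReal.ofReal_coe_nnreal]
    exact ENNReal.ofReal_le_ofReal h1.1

/-- Each visit lasts for an interval open on the right, so rational times suffice. This makes the
hitting time a measurable functional for the product σ-algebra on paths, in which the independence
of walks is expressed. -/
theorem hitTime_eq_iInf_rat (h : ∀ k, 0 < D.wait k ω) (n : ℕ) :
    D.hitTime n ω =
      ⨅ (r : ℚ≥0) (_ : D.walk (r : ℝ≥0) ω = (n : ℕ∞)), ((r : ℝ≥0) : ℝ≥0∞) := by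
  apply le_antisymm
  · exact le_iInf₂ fun r hr => iInf₂_le (r : ℝ≥0) hr
  · refine le_iInf₂ fun t ht => ?_
    obtain ⟨k, h1, hk⟩ := (walk_eq_coe_iff h).1 ht
    refine ENNReal.le_of_forall_pos_le_add fun ε hε _ => ?_
    have h2 : t < min (t + ε) (D.T (k + 1) ω).toNNReal :=
      lt_min (lt_add_of_pos_right _ hε) (Real.lt_toNNReal_iff_coe_lt.2 h1.2)
    obtain ⟨r, hr1, hr2⟩ := exists_rat_btwn (NNReal.coe_lt_coe.2 h2)
    have hr0 : (0 : ℚ) ≤ r := by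
      have : (0 : ℝ) ≤ r := t.2.trans hr1.le
      exact_mod_cast this
    lift r to ℚ≥0 using hr0
    have e : ((r : ℚ) : ℝ) = ((r : ℝ≥0) : ℝ) := by norm_cast
    rw [e] at hr1 hr2
    have hr2' := lt_min_iff.1 (NNReal.coe_lt_coe.1 hr2)
    refine (iInf₂_le r ((walk_eq_coe_iff h).2 ⟨k, ⟨h1.1.trans hr1.le, ?_⟩, hk⟩)).trans ?_
    · exact Real.lt_toNNReal_iff_coe_lt.1 hr2'.2
    · rw [← ENNReal.coe_add]
      exact ENNReal.coe_le_coe.2 hr2'.1.le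

theorem hitTime_of_forall_ne (h : ∀ k, 0 < D.wait k ω) {n : ℕ} (hn : ∀ k, D.X k ω ≠ n) :
    D.hitTime n ω = ⊤ := by
  rw [hitTime_eq_iInf h]; simp [hn]

theorem hitTime_of_first (h : ∀ k, 0 < D.wait k ω) {n N : ℕ} (hN : D.X N ω = n)
    (hlt : ∀ k < N, D.X k ω ≠ n) : D.hitTime n ω = ENNReal.ofReal (D.T N ω) := by
  rw [hitTime_eq_iInf h]
  refine le_antisymm (iInf₂_le N hN) (le_iInf₂ fun k hk => ENNReal.ofReal_le_ofReal ?_)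
  exact (T_strictMono h).monotone (not_lt.1 fun hlt' => hlt k hlt' hk)

/-- The weight of a path that has not yet visited `n`. -/
theorem weight_avoid (n : ℕ) (g : ℝ → ℝ≥0∞) (k : ℕ) (D : WalkData Ω) (ω : Ω) :
    D.weight (fun i t => if i = n then 0 else g t) k ω =
      if ∃ j < k, D.X j ω = n then 0 else ∏ j ∈ Finset.range k, g (D.wait j ω) := by
  unfold weight
  split_ifs with h
  · obtain ⟨j, hj, hX⟩ := h
    exact Finset.prod_eq_zero (Finset.mem_range.2 hj) (by simp [hX])
  · refine Finset.prod_congr rfl fun j hj => if_neg fun hX => h ⟨j, Finset.mem_range.1 hj, hX⟩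

end Pathwise

/-! ### The supermartingale inequality and Laplace transforms of hitting times. -/

section

variable [MeasurableSpace Ω] {p q : ℕ → ℝ} {W : ℕ → Dir → Measure ℝ} {μ : Measure Ω}
  {D : WalkData Ω}

theorem IsWalk.wait_pos (hD : D.IsWalk p q W μ) (ω : Ω) (k : ℕ) : 0 < D.wait k ω := by
  rw [wait_eq]; exact hD.pos _ _ _ _

theorem IsWalk.measurable_T (hD : D.IsWalk p q W μ) (k : ℕ) : Measurable (D.T k) := by
  have : D.T k = fun ω => ∑ j ∈ Finset.range k, D.wait j ω := by ext ω; exact D.T_eq_sum k ω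
  rw [this]
  exact Finset.measurable_fun_sum _ fun j _ => hD.measurable_wait j

theorem IsWalk.measurable_hitTime (hD : D.IsWalk p q W μ) (n : ℕ) : Measurable (D.hitTime n) := by
  have : D.hitTime n = fun ω => ⨅ k : ℕ, if D.X k ω = n then ENNReal.ofReal (D.T k ω) else ⊤ := by
    ext ω
    rw [hitTime_eq_iInf (hD.wait_pos ω)]
    refine iInf_congr fun k => ?_
    by_cases h : D.X k ω = n <;> simp [h]
  rw [this]
  exact Measurable.iInf fun k => Measurable.ite (hD.measurable_X k (measurableSet_singleton n))
    (hD.measurable_T k).ennreal_ofReal measurable_const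

/-- The fundamental supermartingale inequality for functionals of the walk. -/
theorem IsWalk.supermartingale (hD : D.IsWalk p q W μ) (hq0 : q 0 = 0)
    (h₀ B V : ℕ → ℝ≥0∞) {G : ℕ → ℝ → ℝ≥0∞} (hG : ∀ i, Measurable (G i))
    (hV : ∀ i, B i + (ENNReal.ofReal (p i) * ((∫⁻ t, G i t ∂(W i Dir.right)) * V (i + 1)) +
      ENNReal.ofReal (q i) * ((∫⁻ t, G i t ∂(W i Dir.left)) * V (i - 1))) ≤ V i) (K : ℕ) :
    ∑ k ∈ Finset.range K, ∫⁻ ω, h₀ (D.X 0 ω) * D.weight G k ω * B (D.X k ω) ∂μ +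
      ∫⁻ ω, h₀ (D.X 0 ω) * D.weight G K ω * V (D.X K ω) ∂μ ≤
    ∫⁻ ω, h₀ (D.X 0 ω) * V (D.X 0 ω) ∂μ := by
  induction K with
  | zero => simp [weight]
  | succ K ih =>
    refine le_trans ?_ ih
    rw [Finset.sum_range_succ, add_assoc]
    refine add_le_add le_rfl ?_
    -- By the Markov step, the weight at time `K + 1` integrates to the one-step mean of `V`. Adding
    -- `B` to it gives at most `V` at time `K`.
    have hs := hD.lintegral_step K h₀ hG (ψ := fun i j t => G i t * V j)
      (fun i j => (hG i).mul_const _)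
    have e : ∀ ω, h₀ (D.X 0 ω) * D.weight G (K + 1) ω * V (D.X (K + 1) ω) =
        h₀ (D.X 0 ω) * D.weight G K ω * (G (D.X K ω) (D.wait K ω) * V (D.X (K + 1) ω)) := by
      intro ω
      rw [weight, Finset.prod_range_succ, weight]
      ring
    simp_rw [e]
    rw [hs, ← lintegral_add_left]
    · refine lintegral_mono fun ω => ?_
      rw [← mul_add]
      refine mul_le_mul_right ?_ _
      refine le_trans (le_of_eq ?_) (hV (D.X K ω))
      congr 1
      rw [tsum_transProb hq0, jumpDir_succ, jumpDir_pred, lintegral_mul_const _ (hG _),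
        lintegral_mul_const _ (hG _)]
    · exact ((hD.measurable_comp_X h₀ 0).mul (hD.measurable_weight hG K)).mul
        (hD.measurable_comp_X B K)

theorem IsWalk.tsum_le (hD : D.IsWalk p q W μ) (hq0 : q 0 = 0)
    (h₀ B V : ℕ → ℝ≥0∞) {G : ℕ → ℝ → ℝ≥0∞} (hG : ∀ i, Measurable (G i))
    (hV : ∀ i, B i + (ENNReal.ofReal (p i) * ((∫⁻ t, G i t ∂(W i Dir.right)) * V (i + 1)) +
      ENNReal.ofReal (q i) * ((∫⁻ t, G i t ∂(W i Dir.left)) * V (i - 1))) ≤ V i) :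
    ∑' k, ∫⁻ ω, h₀ (D.X 0 ω) * D.weight G k ω * B (D.X k ω) ∂μ ≤
    ∫⁻ ω, h₀ (D.X 0 ω) * V (D.X 0 ω) ∂μ :=
  ENNReal.tsum_le_of_sum_range_le fun K =>
    le_self_add.trans (hD.supermartingale hq0 h₀ B V hG hV K)

/-- Bound for the Laplace transform of a hitting time by a superharmonic function. -/
theorem IsWalk.lintegral_expNeg_hitTime_le (hD : D.IsWalk p q W μ) (hq0 : q 0 = 0)
    (h₀ V : ℕ → ℝ≥0∞) (n : ℕ)
    (hV : ∀ i, i ≠ n → ENNReal.ofReal (p i) *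
      ((∫⁻ t, ENNReal.ofReal (Real.exp (-t)) ∂(W i Dir.right)) * V (i + 1)) +
      ENNReal.ofReal (q i) * ((∫⁻ t, ENNReal.ofReal (Real.exp (-t)) ∂(W i Dir.left)) * V (i - 1))
        ≤ V i) :
    (∫⁻ ω, h₀ (D.X 0 ω) * expNeg (D.hitTime n ω) ∂μ) * V n ≤
      ∫⁻ ω, h₀ (D.X 0 ω) * V (D.X 0 ω) ∂μ := by
  have hm : Measurable fun t : ℝ => ENNReal.ofReal (Real.exp (-t)) := by fun_prop
  set G : ℕ → ℝ → ℝ≥0∞ := fun i t => if i = n then 0 else ENNReal.ofReal (Real.exp (-t)) with hGdef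
  have hG : ∀ i, Measurable (G i) := by
    intro i
    by_cases h : i = n
    · simp only [hGdef, h, if_true]; exact measurable_const
    · simp only [hGdef, h, if_false]; exact hm
  -- `B` collects `V n` on a visit to `n`, and `G` vanishes at `n`. Hence the sum over `k` keeps
  -- only the first visit, with weight `exp (-σ_n)`.
  set B : ℕ → ℝ≥0∞ := fun i => if i = n then V n else 0 with hB
  have key := hD.tsum_le hq0 h₀ B V hG (by
    intro i
    by_cases h : i = n
    · subst h; simp [hB, hGdef]
    · simpa [hB, hGdef, h] using hV i h)
  refine le_trans ?_ key
  have hmh : Measurable fun ω => h₀ (D.X 0 ω) * expNeg (D.hitTime n ω) :=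
    (hD.measurable_comp_X h₀ 0).mul (measurable_expNeg.comp (hD.measurable_hitTime n))
  rw [← lintegral_mul_const _ hmh, ← lintegral_tsum]
  · refine lintegral_mono fun ω => ?_
    by_cases hex : ∃ N, D.X N ω = n
    · have hN := Nat.find_spec hex
      have hlt : ∀ k < Nat.find hex, D.X k ω ≠ n := fun k hk => Nat.find_min hex hk
      refine le_trans (le_of_eq ?_) (ENNReal.le_tsum (Nat.find hex))
      simp only [hB, hN, if_true]
      congr 2
      rw [hitTime_of_first (hD.wait_pos ω) hN hlt, hGdef, weight_avoid, if_neg (by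
        rintro ⟨j, hj, hX⟩; exact hlt j hj hX), expNeg_ofReal (T_nonneg (hD.wait_pos ω) _),
        T_eq_sum, ← Finset.sum_neg_distrib, Real.exp_sum,
        ENNReal.ofReal_prod_of_nonneg fun _ _ => (Real.exp_pos _).le]
    · have : D.hitTime n ω = ⊤ :=
        hitTime_of_forall_ne (hD.wait_pos ω) fun k hk => hex ⟨k, hk⟩
      simp [this, expNeg_top]
  · exact fun k => (((hD.measurable_comp_X h₀ 0).mul (hD.measurable_weight hG k)).mul
      (hD.measurable_comp_X B k)).aemeasurable

end

end WalkData

/-! ### Truncated sums, killing at a set, and the criteria for explosion and hitting. -/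

/-- Only finitely many terms can reach 1, and these are finite. All other terms are unchanged by the
truncation. -/
theorem tsum_ne_top_of_tsum_min_ne_top {ι : Type*} {x : ι → ℝ≥0∞} (hx : ∀ i, x i ≠ ⊤)
    (h : ∑' i, min (x i) 1 ≠ ⊤) : ∑' i, x i ≠ ⊤ := by
  classical
  have hfin := ENNReal.finite_const_le_of_tsum_ne_top h one_ne_zero
  have hle : ∀ i, x i ≤ min (x i) 1 + if i ∈ hfin.toFinset then x i else 0 := by
    intro i
    split_ifs with hi
    · exact le_add_self
    · simp only [Set.Finite.mem_toFinset, Set.mem_ofPred_eq, not_le] at hi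
      rcases le_total (x i) 1 with h1 | h1
      · simp [h1]
      · simp [h1] at hi
  refine ne_top_of_le_ne_top ?_ (ENNReal.tsum_le_tsum hle)
  rw [ENNReal.tsum_add, tsum_eq_sum (s := hfin.toFinset) (fun i hi => if_neg hi)]
  refine ENNReal.add_ne_top.2 ⟨h, ENNReal.sum_ne_top.2 fun i hi => ?_⟩
  rw [if_pos hi]; exact hx i

theorem one_le_tsum_min {ι : Type*} {x : ι → ℝ≥0∞} (h : 1 ≤ ∑' i, x i) :
    1 ≤ ∑' i, min (x i) 1 := by
  by_cases hex : ∃ i, 1 ≤ x i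
  · obtain ⟨i, hi⟩ := hex
    refine le_trans ?_ (ENNReal.le_tsum i)
    simp [hi]
  · push Not at hex
    simpa only [min_eq_left (hex _).le] using h

/-- Each visit to `i` contributes the same nonzero `c i`, so every state is visited finitely often.
-/
theorem tendsto_atTop_of_tsum_ne_top {x : ℕ → ℕ} {c : ℕ → ℝ≥0∞} (hc : ∀ i, c i ≠ 0)
    (h : ∑' k, c (x k) ≠ ⊤) : Tendsto x atTop atTop := by
  rw [← Nat.cofinite_eq_atTop]
  refine Filter.Tendsto.cofinite_of_finite_preimage_singleton fun i => ?_
  refine (ENNReal.finite_const_le_of_tsum_ne_top h (hc i)).subset fun k hk => ?_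
  have : x k = i := hk
  simp [this]

theorem tsum_range_indicator {f : ℕ → ℝ≥0∞} (N : ℕ) :
    ∑' k, (if k < N then f k else 0) = ∑ k ∈ Finset.range N, f k := by
  rw [tsum_eq_sum (s := Finset.range N)]
  · exact Finset.sum_congr rfl fun k hk => if_pos (Finset.mem_range.1 hk)
  · intro k hk; exact if_neg (by simpa using hk)

/-- The mean of `φ` of the waiting time in the state `i`. -/
noncomputable def stepMean (p q : ℕ → ℝ) (W : ℕ → Dir → Measure ℝ) (φ : ℝ → ℝ≥0∞) (i : ℕ) :
    ℝ≥0∞ :=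
  ENNReal.ofReal (p i) * ∫⁻ t, φ t ∂(W i Dir.right) +
    ENNReal.ofReal (q i) * ∫⁻ t, φ t ∂(W i Dir.left)

namespace WalkData

variable {Ω : Type*}

open Classical in
/-- The indicator of the event that the chain has not visited `S` up to the `k`-th step. -/
noncomputable def alive (D : WalkData Ω) (S : Set ℕ) (k : ℕ) (ω : Ω) : ℝ≥0∞ :=
  if ∀ j ≤ k, D.X j ω ∉ S then 1 else 0

-- `weight` sees only the states before time `k`, hence the separate factor for `D.X k`.
open Classical in
theorem weight_alive (D : WalkData Ω) (S : Set ℕ) (k : ℕ) (ω : Ω) :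
    D.weight (fun i _ => if i ∈ S then 0 else 1) k ω * (if D.X k ω ∈ S then 0 else 1) =
      D.alive S k ω := by
  have : D.weight (fun i _ => if i ∈ S then 0 else 1) k ω * (if D.X k ω ∈ S then 0 else 1) =
      ∏ j ∈ Finset.range (k + 1), (if D.X j ω ∈ S then 0 else 1) := by
    rw [Finset.prod_range_succ]; rfl
  rw [this, alive]
  split_ifs with h
  · exact Finset.prod_eq_one fun j hj => if_neg (h j (by simpa [Nat.lt_succ_iff] using hj))
  · push Not at h
    obtain ⟨j, hj, hX⟩ := h
    exact Finset.prod_eq_zero (Finset.mem_range.2 (Nat.lt_succ_of_le hj)) (if_pos hX)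

theorem exists_eq_of_le_succ {x : ℕ → ℕ} (hx : ∀ k, x (k + 1) ≤ x k + 1) {n K : ℕ}
    (h0 : x 0 ≤ n) (hK : n ≤ x K) : ∃ k ≤ K, x k = n := by
  induction K with
  | zero => exact ⟨0, le_rfl, le_antisymm h0 hK⟩
  | succ K ih =>
    by_cases h : n ≤ x K
    · obtain ⟨k, hk, e⟩ := ih h
      exact ⟨k, hk.trans (Nat.le_succ K), e⟩
    · exact ⟨K + 1, le_rfl, by have := hx K; omega⟩

/-- The chain moves up by at most one, so it cannot skip levels above its starting point. The
hitting times of these levels increase and are bounded by the total elapsed time. -/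
theorem explodes_of_tsum_wait_ne_top {D : WalkData Ω} {ω : Ω} (hpos : ∀ k, 0 < D.wait k ω)
    (hx : ∀ k, D.X (k + 1) ω ≤ D.X k ω + 1) (htop : Tendsto (fun k => D.X k ω) atTop atTop)
    (hsum : ∑' k, ENNReal.ofReal (D.wait k ω) ≠ ⊤) : D.Explodes ω := by
  set m := D.X 0 ω with hm
  -- The shift by the initial state `m` is needed: levels below `m` may never be hit.
  have hmono : Monotone fun n => D.hitTime (n + m) ω := by
    refine monotone_nat_of_le_succ fun n => ?_
    rw [hitTime_eq_iInf hpos, hitTime_eq_iInf hpos]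
    refine le_iInf₂ fun K hK => ?_
    obtain ⟨k, hk, e⟩ := exists_eq_of_le_succ (x := fun k => D.X k ω) hx (n := n + m) (K := K)
      (by omega) (by omega)
    exact (iInf₂_le k e).trans (ENNReal.ofReal_le_ofReal ((T_strictMono hpos).monotone hk))
  have hle : ∀ n, D.hitTime (n + m) ω ≤ ∑' k, ENNReal.ofReal (D.wait k ω) := by
    intro n
    obtain ⟨K, hK⟩ := (htop.eventually_ge_atTop (n + m)).exists
    obtain ⟨k, -, e⟩ := exists_eq_of_le_succ (x := fun k => D.X k ω) hx (n := n + m) (K := K)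
      (by omega) hK
    rw [hitTime_eq_iInf hpos]
    refine (iInf₂_le k e).trans ?_
    rw [T_eq_sum, ENNReal.ofReal_sum_of_nonneg fun j _ => (hpos j).le]
    exact ENNReal.sum_le_tsum _
  refine ⟨⨆ n, D.hitTime (n + m) ω, (iSup_le hle).trans_lt hsum.lt_top, ?_⟩
  exact (tendsto_add_atTop_iff_nat m).1 (tendsto_atTop_iSup hmono)

theorem hitTime_eq_tsum_alive {D : WalkData Ω} {ω : Ω} (hpos : ∀ k, 0 < D.wait k ω) {n : ℕ}
    (hex : ∃ k, D.X k ω = n) :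
    D.hitTime n ω = ∑' k, D.alive {n} k ω * ENNReal.ofReal (D.wait k ω) := by
  classical
  have hN := Nat.find_spec hex
  have hlt : ∀ k < Nat.find hex, D.X k ω ≠ n := fun k hk => Nat.find_min hex hk
  rw [hitTime_of_first hpos hN hlt, T_eq_sum, ENNReal.ofReal_sum_of_nonneg fun j _ => (hpos j).le,
    ← tsum_range_indicator]
  refine tsum_congr fun k => ?_
  rw [alive]
  by_cases hk : k < Nat.find hex
  · rw [if_pos hk, if_pos, one_mul]
    intro j hj; exact hlt j (hj.trans_lt hk)
  · rw [if_neg hk, if_neg, zero_mul]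
    intro hal; exact hal _ (not_lt.1 hk) hN

section

variable [MeasurableSpace Ω] {p q : ℕ → ℝ} {W : ℕ → Dir → Measure ℝ} {μ : Measure Ω}
  {D : WalkData Ω}

theorem IsWalk.measurable_alive (hD : D.IsWalk p q W μ) (S : Set ℕ) (k : ℕ) :
    Measurable (D.alive S k) := by
  classical
  have : D.alive S k = fun ω =>
      D.weight (fun i _ => if i ∈ S then 0 else 1) k ω * (if D.X k ω ∈ S then 0 else 1) := by
    ext ω; exact (D.weight_alive S k ω).symm
  rw [this]
  exact (hD.measurable_weight (fun i => measurable_const) k).mul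
    (hD.measurable_comp_X (fun i => if i ∈ S then 0 else 1) k)

/-- Survival up to step `k` depends only on the states up to `X k`, so the Markov step replaces `φ`
of the waiting time by its mean in the current state. -/
theorem IsWalk.lintegral_alive_wait (hD : D.IsWalk p q W μ) (hq0 : q 0 = 0)
    (S : Set ℕ) {φ : ℝ → ℝ≥0∞} (hφ : Measurable φ) (k : ℕ) :
    ∫⁻ ω, D.alive S k ω * φ (D.wait k ω) ∂μ =
      ∫⁻ ω, D.alive S k ω * stepMean p q W φ (D.X k ω) ∂μ := by
  classical
  have := hD.lintegral_step k (fun _ => 1) (G := fun i _ => if i ∈ S then 0 else 1)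
    (fun i => measurable_const) (ψ := fun i _ t => (if i ∈ S then 0 else 1) * φ t)
    (fun i j => hφ.const_mul _)
  simp only [one_mul, tsum_transProb hq0, jumpDir_succ, jumpDir_pred,
    lintegral_const_mul _ hφ] at this
  simp only [← D.weight_alive, mul_assoc]
  rw [this]
  refine lintegral_congr fun ω => ?_
  rw [stepMean]
  ring

theorem IsWalk.tsum_lintegral_alive_le (hWp : ∀ i s, IsProbabilityMeasure (W i s))
    (hD : D.IsWalk p q W μ) (hq0 : q 0 = 0) (S : Set ℕ)
    (b v : ℕ → ℝ≥0∞)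
    (hv : ∀ i, i ∉ S → b i + (ENNReal.ofReal (p i) * v (i + 1) +
      ENNReal.ofReal (q i) * v (i - 1)) ≤ v i) :
    ∫⁻ ω, ∑' k, D.alive S k ω * b (D.X k ω) ∂μ ≤ ∫⁻ ω, v (D.X 0 ω) ∂μ := by
  classical
  have := hD.tsum_le hq0 (fun _ => 1) (fun i => (if i ∈ S then 0 else 1) * b i) v
    (G := fun i _ => if i ∈ S then 0 else 1)
    (fun i => measurable_const) (by
      intro i
      by_cases h : i ∈ S
      · simp [h]
      · simpa [h] using hv i h)
  simp only [one_mul, ← mul_assoc, weight_alive] at this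
  rwa [lintegral_tsum]
  exact fun k => ((hD.measurable_alive S k).mul (hD.measurable_comp_X b k)).aemeasurable

theorem IsWalk.lintegral_tsum_alive_wait_le (hWp : ∀ i s, IsProbabilityMeasure (W i s))
    (hD : D.IsWalk p q W μ) (hq0 : q 0 = 0) (S : Set ℕ)
    {φ : ℝ → ℝ≥0∞} (hφ : Measurable φ) (v : ℕ → ℝ≥0∞)
    (hv : ∀ i, i ∉ S → stepMean p q W φ i + (ENNReal.ofReal (p i) * v (i + 1) +
      ENNReal.ofReal (q i) * v (i - 1)) ≤ v i) :
    ∫⁻ ω, ∑' k, D.alive S k ω * φ (D.wait k ω) ∂μ ≤ ∫⁻ ω, v (D.X 0 ω) ∂μ := by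
  refine le_trans (le_of_eq ?_) (hD.tsum_lintegral_alive_le hWp hq0 S _ v hv)
  rw [lintegral_tsum, lintegral_tsum]
  · exact tsum_congr fun k => hD.lintegral_alive_wait hq0 S hφ k
  · exact fun k => ((hD.measurable_alive S k).mul (hD.measurable_comp_X _ k)).aemeasurable
  · exact fun k => ((hD.measurable_alive S k).mul (hφ.comp (hD.measurable_wait k))).aemeasurable

theorem IsWalk.lintegral_alive_le (hWp : ∀ i s, IsProbabilityMeasure (W i s))
    (hD : D.IsWalk p q W μ) (hq0 : q 0 = 0) (S : Set ℕ)
    (h : ℕ → ℝ≥0∞)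
    (hh : ∀ i, i ∉ S → ENNReal.ofReal (p i) * h (i + 1) + ENNReal.ofReal (q i) * h (i - 1) ≤ h i)
    (k : ℕ) :
    ∫⁻ ω, D.alive S k ω * h (D.X k ω) ∂μ ≤ ∫⁻ ω, h (D.X 0 ω) ∂μ := by
  classical
  have := hD.supermartingale hq0 (fun _ => 1) (fun _ => 0) h
    (G := fun i _ => if i ∈ S then 0 else 1)
    (fun i => measurable_const) (by
      intro i
      by_cases h' : i ∈ S
      · simp [h']
      · simpa [h'] using hh i h') k
  simp only [one_mul, mul_zero, lintegral_zero, Finset.sum_const_zero, zero_add] at this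
  refine le_trans (lintegral_mono fun ω => ?_) this
  rw [← D.weight_alive]
  gcongr
  split_ifs <;> simp

/-- The Markov property constrains only probabilities, so the nearest-neighbour bound is obtained
almost surely, from the Markov step applied to the indicator of a larger jump. -/
theorem IsWalk.ae_le_succ (hD : D.IsWalk p q W μ) :
    ∀ᵐ ω ∂μ, ∀ k, D.X (k + 1) ω ≤ D.X k ω + 1 := by
  refine ae_all_iff.2 fun k => ?_
  have := hD.lintegral_step k (fun _ => 1) (G := fun _ _ => 1) (fun i => measurable_const)
    (ψ := fun i j _ => if j ≤ i + 1 then 0 else 1) (fun i j => measurable_const)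
  have hz : ∀ i, ∑' j, ENNReal.ofReal (transProb p q i j) *
      ∫⁻ t, (if j ≤ i + 1 then 0 else 1) ∂(W i (jumpDir i j)) = 0 := by
    intro i
    refine ENNReal.tsum_eq_zero.2 fun j => ?_
    by_cases h : j ≤ i + 1
    · simp [h]
    · have h1 : j ≠ i + 1 := by omega
      have h2 : j + 1 ≠ i := by omega
      simp [transProb, h1, h2]
  simp only [hz, mul_zero, lintegral_zero, one_mul, weight, Finset.prod_const_one] at this
  rw [lintegral_eq_zero_iff (hD.measurable_comp (ψ := fun i j _ => if j ≤ i + 1 then 0 else 1)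
    (fun i j => measurable_const) k)] at this
  filter_upwards [this] with ω hω
  by_contra hc
  simp [hc] at hω

/-- A criterion of explosion with probability one. -/
theorem IsWalk.ae_explodes [IsProbabilityMeasure μ] (hWp : ∀ i s, IsProbabilityMeasure (W i s))
    (hD : D.IsWalk p q W μ) (hq0 : q 0 = 0)
    (v : ℕ → ℝ≥0∞) {M : ℝ≥0∞} (hM : M ≠ ⊤) (hvM : ∀ i, v i ≤ M)
    (hc : ∀ i, stepMean p q W (fun t => min (ENNReal.ofReal t) 1) i ≠ 0)
    (hv : ∀ i, stepMean p q W (fun t => min (ENNReal.ofReal t) 1) i +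
      (ENNReal.ofReal (p i) * v (i + 1) + ENNReal.ofReal (q i) * v (i - 1)) ≤ v i) :
    ∀ᵐ ω ∂μ, D.Explodes ω := by
  have hφ : Measurable fun t : ℝ => min (ENNReal.ofReal t) 1 := by fun_prop
  have hfin : ∫⁻ ω, v (D.X 0 ω) ∂μ ≠ ⊤ := by
    refine ne_top_of_le_ne_top hM ((lintegral_mono fun ω => hvM _).trans ?_)
    simp
  have h1 := ne_top_of_le_ne_top hfin
    (hD.lintegral_tsum_alive_wait_le hWp hq0 ∅ hφ v fun i _ => hv i)
  have h2 := ne_top_of_le_ne_top hfin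
    (hD.tsum_lintegral_alive_le hWp hq0 ∅ _ v fun i _ => hv i)
  simp only [alive, Set.mem_empty_iff_false, not_false_eq_true, implies_true, if_true,
    one_mul] at h1 h2
  have e1 := ae_lt_top (Measurable.tsum fun k => hφ.comp (hD.measurable_wait k)) h1
  have e2 := ae_lt_top (Measurable.tsum fun k => hD.measurable_comp_X _ k) h2
  filter_upwards [e1, e2, hD.ae_le_succ] with ω a1 a2 a3
  exact explodes_of_tsum_wait_ne_top (hD.wait_pos ω) a3 (tendsto_atTop_of_tsum_ne_top hc a2.ne)
    (tsum_ne_top_of_tsum_min_ne_top (fun k => ENNReal.ofReal_ne_top) a1.ne)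

/-- A criterion of absence of explosion. -/
theorem IsWalk.ae_not_explodes [IsProbabilityMeasure μ] (hD : D.IsWalk p q W μ) (hq0 : q 0 = 0)
    (u : ℕ → ℝ≥0∞) (hu0 : ∀ i, u i ≠ 0) (hut : ∀ i, u i ≠ ⊤) (hu : Tendsto u atTop (𝓝 ⊤))
    (hV : ∀ i, ENNReal.ofReal (p i) *
      ((∫⁻ t, ENNReal.ofReal (Real.exp (-t)) ∂(W i Dir.right)) * u (i + 1)) +
      ENNReal.ofReal (q i) * ((∫⁻ t, ENNReal.ofReal (Real.exp (-t)) ∂(W i Dir.left)) * u (i - 1))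
        ≤ u i) :
    ∀ᵐ ω ∂μ, ¬ D.Explodes ω := by
  -- Dividing by `u` at the initial state makes the bound hold for any initial law, with no
  -- integrability of `u (X 0)`.
  set f : ℕ → Ω → ℝ≥0∞ := fun n ω => (u (D.X 0 ω))⁻¹ * expNeg (D.hitTime n ω) with hf
  have hfm : ∀ n, Measurable (f n) := fun n => (hD.measurable_comp_X (fun i => (u i)⁻¹) 0).mul
    (measurable_expNeg.comp (hD.measurable_hitTime n))
  have hb : ∀ n, ∫⁻ ω, f n ω ∂μ ≤ (u n)⁻¹ := by
    intro n
    have := hD.lintegral_expNeg_hitTime_le hq0 (fun i => (u i)⁻¹) u n (fun i _ => hV i)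
    simp only [ENNReal.inv_mul_cancel (hu0 _) (hut _), lintegral_one, measure_univ] at this
    exact ENNReal.le_inv_iff_mul_le.2 this
  have hinv : Tendsto (fun n => (u n)⁻¹) atTop (𝓝 0) := by
    rw [← ENNReal.inv_top]; exact tendsto_inv_iff.2 hu
  have hlim : Tendsto (fun n => ∫⁻ ω, f n ω ∂μ) atTop (𝓝 0) :=
    tendsto_of_tendsto_of_tendsto_of_le_of_le tendsto_const_nhds hinv (fun _ => zero_le) hb
  have hz : ∫⁻ ω, liminf (fun n => f n ω) atTop ∂μ = 0 := by
    refine le_antisymm ?_ zero_le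
    exact (lintegral_liminf_le hfm).trans hlim.liminf_eq.le
  rw [lintegral_eq_zero_iff (Measurable.liminf hfm)] at hz
  filter_upwards [hz] with ω hω
  rintro ⟨s, hs, hlims⟩
  have hs1 : s < s + 1 := ENNReal.lt_add_right hs.ne one_ne_zero
  -- A finite limit of the hitting times would keep `f n ω` away from 0, while Fatou's lemma makes
  -- its lower limit vanish.
  have hev : ∀ᶠ n in atTop, (u (D.X 0 ω))⁻¹ * expNeg (s + 1) ≤ f n ω := by
    filter_upwards [hlims.eventually (gt_mem_nhds hs1)] with n hn
    exact mul_le_mul_right (expNeg_antitone hn.le) _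
  have h3 := le_liminf_of_le (by isBoundedDefault) hev
  rw [hω] at h3
  have h4 : 0 < (u (D.X 0 ω))⁻¹ * expNeg (s + 1) :=
    ENNReal.mul_pos (ENNReal.inv_ne_zero.2 (hut _))
      (expNeg_pos (ENNReal.add_ne_top.2 ⟨hs.ne, ENNReal.one_ne_top⟩)).ne'
  exact absurd h3 (not_le.2 h4)

/-- A criterion for the state `n` to be hit with probability one. -/
theorem IsWalk.ae_hits (hWp : ∀ i s, IsProbabilityMeasure (W i s))
    (hD : D.IsWalk p q W μ) (hq0 : q 0 = 0) (n : ℕ)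
    (b v h : ℕ → ℝ≥0∞) (hb : ∀ i, b i ≠ 0)
    (hv : ∀ i, i ∉ ({n} : Set ℕ) → b i + (ENNReal.ofReal (p i) * v (i + 1) +
      ENNReal.ofReal (q i) * v (i - 1)) ≤ v i)
    (hh : ∀ i, i ∉ ({n} : Set ℕ) →
      ENNReal.ofReal (p i) * h (i + 1) + ENNReal.ofReal (q i) * h (i - 1) ≤ h i)
    (hvfin : ∫⁻ ω, v (D.X 0 ω) ∂μ ≠ ⊤) (hhfin : ∫⁻ ω, h (D.X 0 ω) ∂μ ≠ ⊤)
    (hlim : Tendsto h atTop (𝓝 ⊤)) :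
    ∀ᵐ ω ∂μ, ∃ k, D.X k ω = n := by
  have h2 := ne_top_of_le_ne_top hvfin (hD.tsum_lintegral_alive_le hWp hq0 {n} _ v hv)
  have hmb : ∀ k, Measurable fun ω => D.alive {n} k ω * b (D.X k ω) := fun k =>
    (hD.measurable_alive {n} k).mul (hD.measurable_comp_X b k)
  have e2 := ae_lt_top (Measurable.tsum hmb) h2
  have hm : ∀ k, Measurable fun ω => D.alive {n} k ω * h (D.X k ω) := fun k =>
    (hD.measurable_alive {n} k).mul (hD.measurable_comp_X h k)
  have h3 : ∫⁻ ω, liminf (fun k => D.alive {n} k ω * h (D.X k ω)) atTop ∂μ ≠ ⊤ := by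
    refine ne_top_of_le_ne_top hhfin ((lintegral_liminf_le hm).trans ?_)
    refine liminf_le_of_le (by isBoundedDefault) fun y hy => ?_
    obtain ⟨k, hk⟩ := hy.exists
    exact hk.trans (hD.lintegral_alive_le hWp hq0 {n} h hh k)
  have e3 := ae_lt_top (Measurable.liminf hm) h3
  filter_upwards [e2, e3] with ω a2 a3
  by_contra hne
  push Not at hne
  -- A path missing `n` is never killed. Finiteness of the `b`-sum sends it to infinity, and then
  -- `h` along it tends to `⊤`, against the Fatou bound.
  have hal : ∀ k, D.alive {n} k ω = 1 := fun k => if_pos fun j _ => hne j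
  simp only [hal, one_mul] at a2 a3
  have := (hlim.comp (tendsto_atTop_of_tsum_ne_top hb a2.ne)).liminf_eq
  simp only [Function.comp_def] at this
  rw [this] at a3
  exact lt_irrefl _ a3

/-- Tail bound for the hitting time of `n`. -/
theorem IsWalk.measure_lt_hitTime_le (hWp : ∀ i s, IsProbabilityMeasure (W i s))
    (hD : D.IsWalk p q W μ) (hq0 : q 0 = 0) (n : ℕ)
    {C : ℝ} (hC : 0 < C) (v : ℕ → ℝ≥0∞)
    (hv : ∀ i, i ∉ ({n} : Set ℕ) →
      stepMean p q W (fun t => min (ENNReal.ofReal (t / C)) 1) i +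
      (ENNReal.ofReal (p i) * v (i + 1) + ENNReal.ofReal (q i) * v (i - 1)) ≤ v i)
    (hex : ∀ᵐ ω ∂μ, ∃ k, D.X k ω = n) :
    μ {ω | ENNReal.ofReal C < D.hitTime n ω} ≤ ∫⁻ ω, v (D.X 0 ω) ∂μ := by
  have hφ : Measurable fun t : ℝ => min (ENNReal.ofReal (t / C)) 1 := by fun_prop
  refine le_trans ?_ (hD.lintegral_tsum_alive_wait_le hWp hq0 {n} hφ v hv)
  have hm : ∀ k, Measurable fun ω =>
      D.alive {n} k ω * min (ENNReal.ofReal (D.wait k ω / C)) 1 := fun k =>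
    (hD.measurable_alive {n} k).mul (hφ.comp (hD.measurable_wait k))
  have hmt : Measurable fun ω => ∑' k, D.alive {n} k ω * min (ENNReal.ofReal (D.wait k ω / C)) 1 :=
    Measurable.tsum hm
  -- Markov's inequality at level 1: if `σ_n > C`, the waiting times divided by `C` sum to at least
  -- 1, and they still do after truncation at 1.
  have hmk := mul_meas_ge_le_lintegral (μ := μ) hmt 1
  rw [one_mul] at hmk
  refine le_trans (measure_mono_ae ?_) hmk
  filter_upwards [hex] with ω hω hlt
  have hlt : ENNReal.ofReal C < D.hitTime n ω := hlt
  rw [hitTime_eq_tsum_alive (hD.wait_pos ω) hω] at hlt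
  have h1 : 1 ≤ ∑' k, D.alive {n} k ω * ENNReal.ofReal (D.wait k ω / C) := by
    have e : ∀ k, D.alive {n} k ω * ENNReal.ofReal (D.wait k ω / C) =
        D.alive {n} k ω * ENNReal.ofReal (D.wait k ω) * (ENNReal.ofReal C)⁻¹ := by
      intro k
      rw [div_eq_mul_inv, ENNReal.ofReal_mul (hD.wait_pos ω k).le, ENNReal.ofReal_inv_of_pos hC,
        mul_assoc]
    simp_rw [e]
    rw [ENNReal.tsum_mul_right, ← div_eq_mul_inv]
    rw [ENNReal.le_div_iff_mul_le (Or.inl (ENNReal.ofReal_pos.2 hC).ne')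
      (Or.inl ENNReal.ofReal_ne_top), one_mul]
    exact hlt.le
  have h2 := one_le_tsum_min h1
  refine h2.trans (ENNReal.tsum_le_tsum fun k => ?_)
  rw [alive]
  split_ifs <;> simp

end

end WalkData

/-! ### Regularly varying tails: truncated means and Laplace transforms. -/

theorem one_sub_cdf_antitone {L : Measure ℝ} {x y : ℝ} (h : x ≤ y) : 1 - cdf L y ≤ 1 - cdf L x :=
  sub_le_sub_left (monotone_cdf L h) 1

theorem one_sub_cdf_nonneg {L : Measure ℝ} (x : ℝ) : 0 ≤ 1 - cdf L x := sub_nonneg.2 (cdf_le_one L x)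

theorem one_sub_cdf_pos {L : Measure ℝ} {ρ : ℝ} (h : RegularlyVarying (fun x => 1 - cdf L x) ρ) (x : ℝ) :
    0 < 1 - cdf L x := by
  obtain ⟨l, ⟨⟨A, hA, -⟩, -⟩, he⟩ := h
  obtain ⟨y, hy1, hy2, hy3, hy4⟩ := (he.and ((eventually_ge_atTop A).and
    ((eventually_ge_atTop x).and (eventually_gt_atTop 0)))).exists
  refine lt_of_lt_of_le ?_ (one_sub_cdf_antitone hy3)
  beta_reduce at hy1
  rw [hy1]
  exact mul_pos (Real.rpow_pos_of_pos hy4 _) (hA y hy2)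

/-- The ratio of the tails at `2 * x` and `x` tends to `2 ^ (-α)`, which exceeds `1 / 2` precisely
because `α < 1`. -/
theorem exists_doubling {L : Measure ℝ} {α : ℝ} (hα : α < 1)
    (h : RegularlyVarying (fun x => 1 - cdf L x) (-α)) :
    ∃ ρ x₀ : ℝ, 1 / 2 < ρ ∧ 0 < x₀ ∧
      ∀ x, x₀ ≤ x → ρ * (1 - cdf L x) ≤ 1 - cdf L (2 * x) := by
  obtain ⟨l, ⟨⟨A, hA, -⟩, hl⟩, he⟩ := h
  have h2 : (1 / 2 : ℝ) < 2 ^ (-α) := by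
    have : (2 : ℝ) ^ (-1 : ℝ) < 2 ^ (-α) :=
      Real.rpow_lt_rpow_of_exponent_lt one_lt_two (by linarith)
    rwa [Real.rpow_neg_one, inv_eq_one_div] at this
  obtain ⟨ρ, hρ1, hρ2⟩ := exists_between h2
  have hpos2 : (0 : ℝ) < 2 ^ (-α) := by linarith
  have hr : ρ / 2 ^ (-α) < 1 := (div_lt_one hpos2).2 hρ2
  have ev1 := (hl 2 two_pos).eventually (lt_mem_nhds hr)
  have ev2 : ∀ᶠ x : ℝ in atTop, 1 - cdf L (2 * x) = (2 * x) ^ (-α) * l (2 * x) :=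
    (tendsto_id.const_mul_atTop two_pos).eventually he
  obtain ⟨x₀, hx₀⟩ := eventually_atTop.1 (ev1.and (ev2.and (he.and
    ((eventually_ge_atTop A).and (eventually_gt_atTop 0)))))
  refine ⟨ρ, max x₀ 1, hρ1, by positivity, fun x hx => ?_⟩
  obtain ⟨h1, h2, h3, h4, h5⟩ := hx₀ x ((le_max_left _ _).trans hx)
  have hlx := hA x h4
  rw [lt_div_iff₀ hlx, div_mul_eq_mul_div, div_lt_iff₀ hpos2] at h1
  beta_reduce at h3
  rw [h2, h3, Real.mul_rpow two_pos.le h5.le]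
  have := Real.rpow_pos_of_pos h5 (-α)
  nlinarith

section Tail

variable {L : Measure ℝ} [IsProbabilityMeasure L]

theorem ofReal_one_sub_cdf (x : ℝ) : ENNReal.ofReal (1 - cdf L x) = L (Set.Ioi x) := by
  rw [cdf_eq_real, ← Set.compl_Iic, prob_compl_eq_one_sub measurableSet_Iic,
    ENNReal.ofReal_sub _ measureReal_nonneg, ENNReal.ofReal_one, measureReal_def,
    ENNReal.ofReal_toReal (measure_ne_top _ _)]

theorem lintegral_min_two_mul_le {a : ℝ} (ha : 0 < a) :
    ∫⁻ x, ENNReal.ofReal (min x (2 * a)) ∂L ≤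
      ∫⁻ x, ENNReal.ofReal (min x a) ∂L + ENNReal.ofReal (a * (1 - cdf L a)) := by
  rw [ENNReal.ofReal_mul ha.le, ofReal_one_sub_cdf, ← lintegral_indicator_const measurableSet_Ioi,
    ← lintegral_add_left (by fun_prop)]
  refine lintegral_mono fun x => ?_
  by_cases hx : a < x
  · rw [Set.indicator_of_mem (Set.mem_Ioi.2 hx), min_eq_right hx.le, ← ENNReal.ofReal_add ha.le ha.le]
    exact ENNReal.ofReal_le_ofReal ((min_le_right _ _).trans (by linarith))
  · rw [Set.indicator_of_notMem (by simpa using hx), add_zero]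
    refine ENNReal.ofReal_le_ofReal ?_
    rw [min_eq_left (not_lt.1 hx)]
    exact min_le_left _ _

/-- A truncated mean is comparable with the tail of the distribution, for tails that vary regularly
with exponent greater than `-1`. -/
theorem exists_lintegral_min_le {α : ℝ} (hα : α < 1)
    (h : RegularlyVarying (fun x => 1 - cdf L x) (-α)) :
    ∃ C : ℝ, ∀ C', C ≤ C' → ∀ a, 0 < a → ∫⁻ x, min (ENNReal.ofReal (x / a)) 1 ∂L ≤
      ENNReal.ofReal (C' * (1 - cdf L a)) := by
  obtain ⟨ρ, x₀, hρ, hx₀, hd⟩ := exists_doubling hα h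
  have hQ := one_sub_cdf_pos h
  -- The first term handles `a ≤ 2 * x₀`, where the truncated mean is at most `a`. The second gives
  -- `C + 1 ≤ 2 * ρ * C`, which lets the bound pass from `a / 2` to `a`.
  refine ⟨max (1 / (1 - cdf L (2 * x₀))) (1 / (2 * ρ - 1)), fun C hC => ?_⟩
  have hC1 : 1 ≤ C * (1 - cdf L (2 * x₀)) :=
    (div_le_iff₀ (hQ _)).1 ((le_max_left _ _).trans hC)
  have hC2 : 1 ≤ C * (2 * ρ - 1) :=
    (div_le_iff₀ (by linarith)).1 ((le_max_right _ _).trans hC)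
  have hC0 : 0 ≤ C := le_trans (by have := hQ (2 * x₀); positivity) ((le_max_left _ _).trans hC)
  have hsmall : ∀ a, 0 < a → a ≤ 2 * x₀ →
      ∫⁻ x, ENNReal.ofReal (min x a) ∂L ≤ ENNReal.ofReal (C * (a * (1 - cdf L a))) := by
    intro a ha hax
    have h1 : ∫⁻ x, ENNReal.ofReal (min x a) ∂L ≤ ENNReal.ofReal a := by
      refine (lintegral_mono fun x => ENNReal.ofReal_le_ofReal (min_le_right x a)).trans ?_
      simp
    refine h1.trans (ENNReal.ofReal_le_ofReal ?_)
    have h2 : 1 ≤ C * (1 - cdf L a) :=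
      hC1.trans (mul_le_mul_of_nonneg_left (one_sub_cdf_antitone hax) hC0)
    nlinarith
  -- Dyadic induction: doubling the truncation level adds at most the level times the tail there.
  have hall : ∀ n : ℕ, ∀ a, 0 < a → a ≤ 2 ^ n * (2 * x₀) →
      ∫⁻ x, ENNReal.ofReal (min x a) ∂L ≤ ENNReal.ofReal (C * (a * (1 - cdf L a))) := by
    intro n
    induction n with
    | zero => intro a ha hax; exact hsmall a ha (by simpa using hax)
    | succ n ih =>
      intro a ha hax
      by_cases hs : a ≤ 2 * x₀
      · exact hsmall a ha hs
      push Not at hs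
      have ha2 : 0 < a / 2 := by positivity
      have h1 := ih (a / 2) ha2 (by rw [pow_succ] at hax; linarith)
      have h2 := lintegral_min_two_mul_le (L := L) ha2
      rw [show 2 * (a / 2) = a by ring] at h2
      have h3 := hd (a / 2) (by linarith)
      rw [show 2 * (a / 2) = a by ring] at h3
      refine h2.trans ((add_le_add_left h1 _).trans ?_)
      have hQ2 := hQ (a / 2)
      rw [← ENNReal.ofReal_add (by positivity) (by positivity)]
      refine ENNReal.ofReal_le_ofReal ?_
      have h4 : (C + 1) * (1 - cdf L (a / 2)) ≤ 2 * C * (1 - cdf L a) := by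
        have : 2 * C * (ρ * (1 - cdf L (a / 2))) ≤ 2 * C * (1 - cdf L a) :=
          mul_le_mul_of_nonneg_left h3 (by positivity)
        nlinarith
      nlinarith
  intro a ha
  obtain ⟨n, hn⟩ := pow_unbounded_of_one_lt (a / (2 * x₀)) (one_lt_two (α := ℝ))
  have hn' : a ≤ 2 ^ n * (2 * x₀) := ((div_lt_iff₀ (by positivity)).1 hn).le
  have key := hall n a ha hn'
  have e : ∀ x : ℝ, min (ENNReal.ofReal (x / a)) 1 =
      ENNReal.ofReal (min x a) * ENNReal.ofReal a⁻¹ := by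
    intro x
    rw [← ENNReal.ofReal_mul' (by positivity), ← ENNReal.ofReal_one, ← ENNReal.ofReal_min,
      min_mul_of_nonneg _ _ (by positivity : (0 : ℝ) ≤ a⁻¹), mul_inv_cancel₀ ha.ne',
      div_eq_mul_inv]
  simp_rw [e]
  rw [lintegral_mul_const _ (by fun_prop)]
  refine (mul_le_mul_left key _).trans ?_
  rw [← ENNReal.ofReal_mul (by have := hQ a; positivity)]
  refine ENNReal.ofReal_le_ofReal (le_of_eq ?_)
  field_simp

theorem tail_le_lintegral_min {a : ℝ} (ha : 0 < a) :
    ENNReal.ofReal (1 - cdf L a) ≤ ∫⁻ x, min (ENNReal.ofReal (x / a)) 1 ∂L := by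
  rw [ofReal_one_sub_cdf, ← lintegral_indicator_one measurableSet_Ioi]
  refine lintegral_mono fun x => ?_
  by_cases hx : a < x
  · rw [Set.indicator_of_mem (Set.mem_Ioi.2 hx)]
    refine le_min ?_ le_rfl
    rw [Pi.one_apply, ← ENNReal.ofReal_one]
    exact ENNReal.ofReal_le_ofReal ((one_le_div ha).2 hx.le)
  · rw [Set.indicator_of_notMem (by simpa using hx)]
    exact zero_le

/-- The exponential is at most 1, and at most `exp (-1)` on `x > a`, so the tail at `a` costs the
factor `1 - exp (-1)`. -/
theorem exists_laplace (hL : L (Set.Iic 0) = 0) {a : ℝ} (ha : 0 < a) :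
    ∃ f : ℝ, 0 < f ∧ f ≤ 1 - (1 - Real.exp (-1)) * (1 - cdf L a) ∧
      ENNReal.ofReal f = ∫⁻ x, ENNReal.ofReal (Real.exp (-(x / a))) ∂L := by
  have hae : ∀ᵐ x ∂L, 0 < x := by
    rw [ae_iff]; simpa [Set.Iic] using hL
  have he1 : Real.exp (-1) < 1 := by
    rw [← Real.exp_zero]; exact Real.exp_lt_exp.2 (by norm_num)
  have hγ : 0 ≤ (1 - Real.exp (-1)) * (1 - cdf L a) :=
    mul_nonneg (by linarith) (one_sub_cdf_nonneg a)
  set I := ∫⁻ x, ENNReal.ofReal (Real.exp (-(x / a))) ∂L with hI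
  have hsum : I + ENNReal.ofReal ((1 - Real.exp (-1)) * (1 - cdf L a)) ≤ 1 := by
    rw [ENNReal.ofReal_mul (by linarith), ofReal_one_sub_cdf,
      ← lintegral_indicator_const measurableSet_Ioi, hI, ← lintegral_add_left (by fun_prop)]
    calc _ ≤ ∫⁻ _, 1 ∂L := lintegral_mono_ae ?_
      _ = 1 := by simp
    filter_upwards [hae] with x hx0
    have h0 : 0 < x / a := by positivity
    by_cases hx : a < x
    · rw [Set.indicator_of_mem (Set.mem_Ioi.2 hx),
        ← ENNReal.ofReal_add (Real.exp_pos _).le (by linarith), ← ENNReal.ofReal_one]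
      refine ENNReal.ofReal_le_ofReal ?_
      have : Real.exp (-(x / a)) ≤ Real.exp (-1) :=
        Real.exp_le_exp.2 (neg_le_neg ((one_le_div ha).2 hx.le))
      linarith
    · rw [Set.indicator_of_notMem (by simpa using hx), add_zero, ← ENNReal.ofReal_one]
      exact ENNReal.ofReal_le_ofReal (Real.exp_le_one_iff.2 (by linarith))
  have hI1 : I ≠ ⊤ := ne_top_of_le_ne_top ENNReal.one_ne_top (le_self_add.trans hsum)
  have hI0 : I ≠ 0 := by
    rw [hI, Ne, lintegral_eq_zero_iff (by fun_prop)]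
    intro hz
    have : ∀ᵐ x ∂L, False := by
      filter_upwards [hz] with x hx
      simp only [Pi.zero_apply, ENNReal.ofReal_eq_zero] at hx
      exact absurd hx (not_le.2 (Real.exp_pos _))
    simp at this
    exact IsProbabilityMeasure.ne_zero L this
  refine ⟨I.toReal, ENNReal.toReal_pos hI0 hI1, ?_, ENNReal.ofReal_toReal hI1⟩
  have := ENNReal.toReal_mono ENNReal.one_ne_top hsum
  rw [ENNReal.toReal_add hI1 ENNReal.ofReal_ne_top, ENNReal.toReal_ofReal hγ,
    ENNReal.toReal_one] at this
  linarith

end Tail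

/-! ### Truncated mean waiting times. -/

section Step

variable {p q : ℕ → ℝ} {W : ℕ → Dir → Measure ℝ}

theorem stepMean_mono {φ ψ : ℝ → ℝ≥0∞} (h : ∀ t, φ t ≤ ψ t) (i : ℕ) :
    stepMean p q W φ i ≤ stepMean p q W ψ i := by
  unfold stepMean
  gcongr <;> exact h _

theorem tendsto_stepMean_truncation (hWp : ∀ i s, IsProbabilityMeasure (W i s)) (i : ℕ) :
    Tendsto (fun C : ℝ => stepMean p q W (fun t => min (ENNReal.ofReal (t / C)) 1) i)
      atTop (𝓝 0) := by
  have h : ∀ s, Tendsto (fun C : ℝ => ∫⁻ t, min (ENNReal.ofReal (t / C)) 1 ∂(W i s))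
      atTop (𝓝 0) := by
    intro s
    have := tendsto_lintegral_filter_of_dominated_convergence (μ := W i s) (l := atTop)
      (F := fun (C : ℝ) t => min (ENNReal.ofReal (t / C)) 1) (f := fun _ => 0) (fun _ => 1)
      (Eventually.of_forall fun C => by fun_prop)
      (Eventually.of_forall fun C => Eventually.of_forall fun t => min_le_right _ _)
      (by simp) (Eventually.of_forall fun t => by
        have h1 : Tendsto (fun C : ℝ => ENNReal.ofReal (t / C)) atTop (𝓝 0) := by
          rw [← ENNReal.ofReal_zero]
          exact ENNReal.tendsto_ofReal (tendsto_const_nhds.div_atTop tendsto_id)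
        refine tendsto_of_tendsto_of_tendsto_of_le_of_le tendsto_const_nhds h1
          (fun _ => zero_le) (fun _ => min_le_left _ _))
    simpa using this
  have h1 := ENNReal.Tendsto.const_mul (a := ENNReal.ofReal (p i)) (h Dir.right)
    (Or.inr ENNReal.ofReal_ne_top)
  have h2 := ENNReal.Tendsto.const_mul (a := ENNReal.ofReal (q i)) (h Dir.left)
    (Or.inr ENNReal.ofReal_ne_top)
  simpa [stepMean] using h1.add h2

theorem truncation_le {C : ℝ} (hC : 1 ≤ C) (t : ℝ) :
    min (ENNReal.ofReal (t / C)) 1 ≤ min (ENNReal.ofReal t) 1 := by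
  refine min_le_min ?_ le_rfl
  rcases le_total 0 t with ht | ht
  · exact ENNReal.ofReal_le_ofReal (div_le_self ht hC)
  · rw [ENNReal.ofReal_of_nonpos (div_nonpos_of_nonpos_of_nonneg ht (by linarith))]
    exact zero_le

end Step

/-! ### Green kernels and first-step recursions. -/

/-- The expected number of visits to `j` of the chain started at `n`, before it hits `n + 1`. -/
noncomputable def upKernel (p q : ℕ → ℝ) (j n : ℕ) : ℝ≥0∞ :=
  ENNReal.ofReal ((∏ l ∈ Finset.Ioc j n, q l) / ∏ l ∈ Finset.Icc j n, p l)

/-- The expected number of visits to `i` of the chain started at `k + 1`, before it hits `k`. -/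
noncomputable def downKernel (p q : ℕ → ℝ) (k i : ℕ) : ℝ≥0∞ :=
  ENNReal.ofReal ((∏ l ∈ Finset.Ioo k i, p l) / ∏ l ∈ Finset.Ioc k i, q l)

/-- The mean of an additive functional on the passage from `n` to `n + 1`. -/
noncomputable def upMean (p q : ℕ → ℝ) (m : ℕ → ℝ≥0∞) (n : ℕ) : ℝ≥0∞ :=
  ∑ j ∈ Finset.range (n + 1), m j * upKernel p q j n

/-- The mean of an additive functional on the passage from `k + 1` to `k`. -/
noncomputable def downMean (p q : ℕ → ℝ) (m : ℕ → ℝ≥0∞) (k : ℕ) : ℝ≥0∞ :=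
  ∑' j, m (k + 1 + j) * downKernel p q k (k + 1 + j)

/-- Tonelli: the pairs `i ≤ n` are summed with the passage level `n` outside. -/
theorem explosionSeries_eq (p q : ℕ → ℝ) (L : Dir → Measure ℝ) (a : Dir → ℕ → ℝ) :
    explosionSeries p q L a =
      ∑' n, upMean p q (fun i => ENNReal.ofReal (meanTail p q L a i)) n := by
  classical
  have h : ∀ n, upMean p q (fun i => ENNReal.ofReal (meanTail p q L a i)) n = ∑' j,
      if j ≤ n then ENNReal.ofReal (meanTail p q L a j) * upKernel p q j n else 0 := by
    intro n
    rw [upMean, ← tsum_range_indicator]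
    simp only [Nat.lt_succ_iff]
  simp_rw [h]
  rw [ENNReal.tsum_comm, explosionSeries]
  refine tsum_congr fun i => ?_
  rw [← ENNReal.tsum_mul_left]
  refine (tsum_subtype (Set.Ici i)
    (fun k => ENNReal.ofReal (meanTail p q L a i) * upKernel p q i k)).trans ?_
  refine tsum_congr fun k => ?_
  simp [Set.indicator_apply]

theorem implosionSeries_eq (p q : ℕ → ℝ) (L : Dir → Measure ℝ) (a : Dir → ℕ → ℝ) :
    implosionSeries p q L a =
      ∑' k, downMean p q (fun i => ENNReal.ofReal (meanTail p q L a i)) k := by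
  classical
  have h : ∀ k, downMean p q (fun i => ENNReal.ofReal (meanTail p q L a i)) k = ∑' i,
      if k < i then ENNReal.ofReal (meanTail p q L a i) * downKernel p q k i else 0 := by
    intro k
    have hinj : Function.Injective fun j => k + 1 + j := fun _ _ h => by simpa using h
    rw [downMean, ← hinj.tsum_eq (f := fun i =>
      if k < i then ENNReal.ofReal (meanTail p q L a i) * downKernel p q k i else 0)]
    · refine tsum_congr fun j => ?_
      rw [if_pos (by omega)]
    · intro i hi
      have : k < i := by
        by_contra hc
        simp [hc] at hi
      exact ⟨i - (k + 1), by simp only; omega⟩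
  simp_rw [h]
  rw [ENNReal.tsum_comm, implosionSeries]
  rw [tsum_subtype (Set.Ici 1) (fun i => ENNReal.ofReal (meanTail p q L a i) *
    ∑ k ∈ Finset.range i, ENNReal.ofReal ((∏ j ∈ Finset.Ioo k i, p j) / ∏ j ∈ Finset.Ioc k i, q j))]
  refine tsum_congr fun i => ?_
  rw [tsum_range_indicator, ← Finset.mul_sum]
  rcases i with _ | i
  · simp
  · rw [Set.indicator_of_mem (by simp)]; rfl

section Kernels

variable {p q : ℕ → ℝ}

theorem upKernel_self (hp : ∀ i, 0 < p i) (n : ℕ) :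
    ENNReal.ofReal (p n) * upKernel p q n n = 1 := by
  rw [upKernel, ← ENNReal.ofReal_mul (hp n).le]
  simp [(hp n).ne']

theorem upKernel_succ (hp : ∀ i, 0 < p i) (hq : ∀ i, 1 ≤ i → 0 < q i) {j n : ℕ} (h : j ≤ n) :
    ENNReal.ofReal (p (n + 1)) * upKernel p q j (n + 1) =
      ENNReal.ofReal (q (n + 1)) * upKernel p q j n := by
  rw [upKernel, upKernel, ← ENNReal.ofReal_mul (hp _).le,
    ← ENNReal.ofReal_mul (hq (n + 1) (by omega)).le]
  congr 1
  rw [← Finset.insert_Icc_right_eq_Icc_add_one (by omega),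
    ← Finset.insert_Ioc_right_eq_Ioc_add_one h, Finset.prod_insert (by simp),
    Finset.prod_insert (by simp)]
  have h1 := (hp (n + 1)).ne'
  have h2 : (∏ l ∈ Finset.Icc j n, p l) ≠ 0 := Finset.prod_ne_zero_iff.2 fun l _ => (hp l).ne'
  field_simp

/-- First-step analysis: a step down from `n` costs the passage from `n - 1` to `n` and then a fresh
passage from `n`. At `n = 0` the spurious index `n - 1 = 0` has coefficient `q 0 = 0`. -/
theorem upMean_rec (hp : ∀ i, 0 < p i) (hq0 : q 0 = 0) (hq : ∀ i, 1 ≤ i → 0 < q i)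
    (m : ℕ → ℝ≥0∞) (n : ℕ) :
    ENNReal.ofReal (p n) * upMean p q m n =
      ENNReal.ofReal (q n) * upMean p q m (n - 1) + m n := by
  have e : ∀ n, ENNReal.ofReal (p n) * (m n * upKernel p q n n) = m n := fun n => by
    rw [mul_left_comm, upKernel_self hp, mul_one]
  rcases n with _ | n
  · rw [hq0, ENNReal.ofReal_zero, zero_mul, zero_add, upMean, Finset.sum_range_one, e]
  · rw [upMean, Finset.sum_range_succ, mul_add, e, Nat.add_sub_cancel, upMean, Finset.mul_sum,
      Finset.mul_sum]
    congr 1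
    refine Finset.sum_congr rfl fun j hj => ?_
    rw [mul_left_comm, upKernel_succ hp hq (Nat.lt_succ_iff.1 (Finset.mem_range.1 hj)),
      mul_left_comm]

theorem downKernel_self (hq : ∀ i, 1 ≤ i → 0 < q i) (k : ℕ) :
    ENNReal.ofReal (q (k + 1)) * downKernel p q k (k + 1) = 1 := by
  have h := hq (k + 1) (by omega)
  have e1 : Finset.Ioo k (k + 1) = ∅ := by ext x; simp
  have e2 : Finset.Ioc k (k + 1) = {k + 1} := by ext x; simp
  rw [downKernel, ← ENNReal.ofReal_mul h.le, e1, e2]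
  simp [h.ne']

theorem downKernel_succ (hp : ∀ i, 0 < p i) (hq : ∀ i, 1 ≤ i → 0 < q i) {k i : ℕ}
    (hi : k + 1 < i) :
    ENNReal.ofReal (q (k + 1)) * downKernel p q k i =
      ENNReal.ofReal (p (k + 1)) * downKernel p q (k + 1) i := by
  have h := hq (k + 1) (by omega)
  rw [downKernel, downKernel, ← ENNReal.ofReal_mul h.le, ← ENNReal.ofReal_mul (hp _).le]
  congr 1
  have e1 : Finset.Ioo k i = insert (k + 1) (Finset.Ioo (k + 1) i) := by
    ext x; simp only [Finset.mem_Ioo, Finset.mem_insert]; omega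
  have e2 : Finset.Ioc k i = insert (k + 1) (Finset.Ioc (k + 1) i) := by
    ext x; simp only [Finset.mem_Ioc, Finset.mem_insert]; omega
  rw [e1, e2, Finset.prod_insert (by simp), Finset.prod_insert (by simp)]
  have h2 : (∏ l ∈ Finset.Ioc (k + 1) i, q l) ≠ 0 := Finset.prod_ne_zero_iff.2 fun l hl =>
    (hq l (by have := (Finset.mem_Ioc.1 hl).1; omega)).ne'
  have h1 := h.ne'
  field_simp

theorem downMean_rec (hp : ∀ i, 0 < p i) (hq : ∀ i, 1 ≤ i → 0 < q i) (m : ℕ → ℝ≥0∞) (k : ℕ) :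
    ENNReal.ofReal (q (k + 1)) * downMean p q m k =
      m (k + 1) + ENNReal.ofReal (p (k + 1)) * downMean p q m (k + 1) := by
  rw [downMean, tsum_eq_zero_add' ENNReal.summable, mul_add, add_zero, mul_left_comm,
    downKernel_self hq, mul_one, downMean, ← ENNReal.tsum_mul_left, ← ENNReal.tsum_mul_left]
  congr 1
  refine tsum_congr fun j => ?_
  rw [show k + 1 + (j + 1) = k + 1 + 1 + j by omega, mul_left_comm,
    downKernel_succ hp hq (by omega), mul_left_comm]

/-- This is the recursion of `downMean_rec` with zero cost: `δ` gives the increments of a harmonic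
function of the embedded chain. -/
theorem delta_succ (hp : ∀ i, 0 < p i) (k : ℕ) :
    q (k + 1) * delta p q k = p (k + 1) * delta p q (k + 1) := by
  rw [delta, delta, ← Finset.insert_Icc_right_eq_Icc_add_one (by omega),
    Finset.prod_insert (by simp), Finset.prod_insert (by simp)]
  have h2 : (∏ l ∈ Finset.Icc 1 k, p l) ≠ 0 := Finset.prod_ne_zero_iff.2 fun l _ => (hp l).ne'
  have := (hp (k + 1)).ne'
  field_simp

theorem delta_pos (hp : ∀ i, 0 < p i) (hq : ∀ i, 1 ≤ i → 0 < q i) (k : ℕ) : 0 < delta p q k :=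
  div_pos (Finset.prod_pos fun l hl => hq l (Finset.mem_Icc.1 hl).1)
    (Finset.prod_pos fun l _ => hp l)

theorem downMean_mono {m m' : ℕ → ℝ≥0∞} (h : ∀ i, m i ≤ m' i) (k : ℕ) :
    downMean p q m k ≤ downMean p q m' k :=
  ENNReal.tsum_le_tsum fun _ => mul_le_mul_left (h _) _

theorem upMean_mono {m m' : ℕ → ℝ≥0∞} (h : ∀ i, m i ≤ m' i) (n : ℕ) :
    upMean p q m n ≤ upMean p q m' n :=
  Finset.sum_le_sum fun _ _ => mul_le_mul_left (h _) _

theorem downMean_const_mul (c : ℝ≥0∞) (m : ℕ → ℝ≥0∞) (k : ℕ) :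
    downMean p q (fun i => c * m i) k = c * downMean p q m k := by
  simp_rw [downMean, mul_assoc, ENNReal.tsum_mul_left]

theorem upMean_const_mul (c : ℝ≥0∞) (m : ℕ → ℝ≥0∞) (n : ℕ) :
    upMean p q (fun i => c * m i) n = c * upMean p q m n := by
  simp_rw [upMean, mul_assoc, Finset.mul_sum]

end Kernels

/-! ### Superharmonic functions for convergent series. -/

section Superharmonic

variable {p q : ℕ → ℝ}

/-- The mean of an additive functional up to infinity is superharmonic. -/
theorem upMean_superharmonic (hp : ∀ i, 0 < p i) (hq0 : q 0 = 0) (hq : ∀ i, 1 ≤ i → 0 < q i)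
    (hpq : ∀ i, p i + q i = 1) (m : ℕ → ℝ≥0∞) (i : ℕ) :
    m i + (ENNReal.ofReal (p i) * ∑' n, upMean p q m (i + 1 + n) +
      ENNReal.ofReal (q i) * ∑' n, upMean p q m (i - 1 + n)) ≤ ∑' n, upMean p q m (i + n) := by
  have hrec := upMean_rec hp hq0 hq m i
  have hq' : 0 ≤ q i := by
    rcases i with _ | i
    · exact hq0.ge
    · exact (hq _ (by omega)).le
  have h1 : ENNReal.ofReal (p i) + ENNReal.ofReal (q i) = 1 := by
    rw [← ENNReal.ofReal_add (hp i).le hq', hpq, ENNReal.ofReal_one]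
  have e : ∀ i, ∑' n, upMean p q m (i + n) =
      upMean p q m i + ∑' n, upMean p q m (i + 1 + n) := by
    intro i
    rw [tsum_eq_zero_add' ENNReal.summable, add_zero]
    simp only [add_assoc, add_comm 1]
  rcases i with _ | i
  · rw [e 0]
    simp only [hq0, ENNReal.ofReal_zero, zero_mul, add_zero, zero_add] at hrec h1 ⊢
    rw [h1, one_mul, ← hrec, h1, one_mul]
  · rw [Nat.add_sub_cancel, e i, e (i + 1)]
    rw [Nat.add_sub_cancel] at hrec
    set P := ENNReal.ofReal (p (i + 1))
    set Q := ENNReal.ofReal (q (i + 1))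
    set S := ∑' n, upMean p q m (i + 1 + 1 + n)
    set A := upMean p q m i
    set B := upMean p q m (i + 1)
    calc m (i + 1) + (P * S + Q * (A + (B + S)))
        = (Q * A + m (i + 1)) + Q * B + (P + Q) * S := by ring
      _ = (P + Q) * B + (P + Q) * S := by rw [← hrec]; ring
      _ ≤ B + S := by rw [h1, one_mul, one_mul]

/-- The superharmonic function on `{n, n + 1, …}` with increments `d`. -/
noncomputable def potential (d : ℕ → ℝ≥0∞) (n i : ℕ) : ℝ≥0∞ :=
  if i < n then ⊤ else ∑ k ∈ Finset.Ico n i, d k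

theorem potential_superharmonic (hp : ∀ i, 0 < p i) (hq : ∀ i, 1 ≤ i → 0 < q i)
    (hpq : ∀ i, p i + q i = 1) {m d : ℕ → ℝ≥0∞}
    (hd : ∀ k, ENNReal.ofReal (q (k + 1)) * d k =
      m (k + 1) + ENNReal.ofReal (p (k + 1)) * d (k + 1)) (n i : ℕ) (hi : i ∉ ({n} : Set ℕ)) :
    m i + (ENNReal.ofReal (p i) * potential d n (i + 1) +
      ENNReal.ofReal (q i) * potential d n (i - 1)) ≤ potential d n i := by
  rcases lt_or_gt_of_ne (show i ≠ n from hi) with h | h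
  -- Below `n` the value `⊤` makes the inequality trivial. Above `n` it never enters, as `i - 1 ≥
  -- n`.
  · rw [potential, potential, potential, if_pos h]; exact le_top
  · obtain ⟨i, rfl⟩ : ∃ j, i = j + 1 := ⟨i - 1, by omega⟩
    have h1 : ENNReal.ofReal (p (i + 1)) + ENNReal.ofReal (q (i + 1)) = 1 := by
      rw [← ENNReal.ofReal_add (hp _).le (hq _ (by omega)).le, hpq, ENNReal.ofReal_one]
    have hrec := hd i
    rw [Nat.add_sub_cancel, potential, potential, potential, if_neg (by omega), if_neg (by omega),
      if_neg (by omega), Finset.sum_Ico_succ_top (by omega), Finset.sum_Ico_succ_top (by omega)]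
    set P := ENNReal.ofReal (p (i + 1))
    set Q := ENNReal.ofReal (q (i + 1))
    set S := ∑ k ∈ Finset.Ico n i, d k
    calc m (i + 1) + (P * (S + d i + d (i + 1)) + Q * S)
        = (P + Q) * S + P * d i + (m (i + 1) + P * d (i + 1)) := by ring
      _ = (P + Q) * S + (P + Q) * d i := by rw [← hrec]; ring
      _ ≤ S + d i := by rw [h1, one_mul, one_mul]

theorem potential_self_succ (d : ℕ → ℝ≥0∞) (n : ℕ) : potential d n (n + 1) = d n := by
  simp [potential]

theorem potential_le_tsum (d : ℕ → ℝ≥0∞) {n i : ℕ} (h : n ≤ i) :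
    potential d n i ≤ ∑' k, d k := by
  rw [potential, if_neg (not_lt.2 h)]
  exact ENNReal.sum_le_tsum _

theorem tendsto_potential {d : ℕ → ℝ≥0∞} (hd : ∀ k, d k ≠ ⊤) (h : ∑' k, d k = ⊤) (n : ℕ) :
    Tendsto (potential d n) atTop (𝓝 ⊤) := by
  have h1 := ENNReal.tendsto_nat_tsum d
  rw [h] at h1
  have hS : ∑ k ∈ Finset.range n, d k ≠ ⊤ := ENNReal.sum_ne_top.2 fun k _ => hd k
  have h2 := ENNReal.Tendsto.sub h1 (tendsto_const_nhds (x := ∑ k ∈ Finset.range n, d k))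
    (Or.inr hS)
  rw [ENNReal.top_sub hS] at h2
  refine h2.congr' ?_
  filter_upwards [eventually_ge_atTop n] with i hi
  rw [potential, if_neg (not_lt.2 hi), ← Finset.sum_range_add_sum_Ico _ hi]
  exact ENNReal.add_sub_cancel_left hS

end Superharmonic

/-! ### Superharmonic functions for divergent series. -/

section Laplace

variable {p q : ℕ → ℝ} {f t : Dir → ℕ → ℝ} {γ : ℝ}

/-- The pair of the values at `i - 1` and `i` of the increasing solution of
`u i = p i * f⁺ i * u (i + 1) + q i * f⁻ i * u (i - 1)`. -/
noncomputable def solutionPair (p q : ℕ → ℝ) (f : Dir → ℕ → ℝ) : ℕ → ℝ × ℝ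
  | 0 => (1, 1)
  | i + 1 => ((solutionPair p q f i).2,
      ((solutionPair p q f i).2 - q i * f Dir.left i * (solutionPair p q f i).1) /
        (p i * f Dir.right i))

theorem solutionPair_monotone (hp : ∀ i, 0 < p i) (hq : ∀ i, 0 ≤ q i) (hpq : ∀ i, p i + q i = 1)
    (hf0 : ∀ s i, 0 < f s i) (hf1 : ∀ s i, f s i ≤ 1) (i : ℕ) :
    0 < (solutionPair p q f i).1 ∧ (solutionPair p q f i).1 ≤ (solutionPair p q f i).2 := by
  induction i with
  | zero => simp [solutionPair]
  | succ i ih =>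
    rw [solutionPair]
    refine ⟨ih.1.trans_le ih.2, ?_⟩
    dsimp only
    set x := (solutionPair p q f i).1
    set y := (solutionPair p q f i).2
    rw [le_div_iff₀ (mul_pos (hp i) (hf0 _ i))]
    have h1 : q i * f Dir.left i * x ≤ q i * y := by
      have := mul_le_mul (hf1 Dir.left i) ih.2 ih.1.le zero_le_one
      rw [mul_assoc]
      exact mul_le_mul_of_nonneg_left (by linarith) (hq i)
    have h2 : y * (p i * f Dir.right i) ≤ y * p i :=
      mul_le_mul_of_nonneg_left (mul_le_of_le_one_right (hp i).le (hf1 _ i))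
        (ih.1.le.trans ih.2)
    have h3 : y * p i + q i * y = y := by rw [mul_comm (q i), ← mul_add, hpq, mul_one]
    linarith

/-- The function that shows the absence of explosion. -/
theorem exists_superharmonic_tendsto_top (hp : ∀ i, 0 < p i) (hq0 : q 0 = 0)
    (hq : ∀ i, 1 ≤ i → 0 < q i) (hpq : ∀ i, p i + q i = 1) (hγ : 0 < γ)
    (hf0 : ∀ s i, 0 < f s i) (ht : ∀ s i, 0 ≤ t s i) (hf : ∀ s i, f s i ≤ 1 - γ * t s i)
    (hE : ∑' n, upMean p q
      (fun i => ENNReal.ofReal (p i * t Dir.right i + q i * t Dir.left i)) n = ⊤) :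
    ∃ u : ℕ → ℝ≥0∞, (∀ i, u i ≠ 0) ∧ (∀ i, u i ≠ ⊤) ∧ Tendsto u atTop (𝓝 ⊤) ∧
      ∀ i, ENNReal.ofReal (p i) * (ENNReal.ofReal (f Dir.right i) * u (i + 1)) +
        ENNReal.ofReal (q i) * (ENNReal.ofReal (f Dir.left i) * u (i - 1)) ≤ u i := by
  have hqn : ∀ i, 0 ≤ q i := by
    intro i
    rcases i with _ | i
    · exact hq0.ge
    · exact (hq _ (by omega)).le
  have hf1 : ∀ s i, f s i ≤ 1 := fun s i =>
    (hf s i).trans (by have := mul_nonneg hγ.le (ht s i); linarith)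
  have hmon := solutionPair_monotone hp hqn hpq hf0 hf1
  set u : ℕ → ℝ := fun i => (solutionPair p q f i).2 with hu
  -- The initial pair `(1, 1)` agrees with the convention `0 - 1 = 0`.
  have hpair : ∀ i, (solutionPair p q f i).1 = u (i - 1) := by
    intro i
    rcases i with _ | i <;> simp [solutionPair, hu]
  have hupos : ∀ i, 0 < u i := fun i => (hmon i).1.trans_le (hmon i).2
  have hstep : ∀ i, u i ≤ u (i + 1) := fun i => (hmon (i + 1)).2
  have hle : ∀ i, u (i - 1) ≤ u i := fun i => by rw [← hpair]; exact (hmon i).2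
  have hu1 : ∀ i, 1 ≤ u i := by
    intro i
    induction i with
    | zero => simp [hu, solutionPair]
    | succ i ih => exact ih.trans (hstep i)
  have heq : ∀ i, p i * f Dir.right i * u (i + 1) + q i * f Dir.left i * u (i - 1) = u i := by
    intro i
    have h0 : p i * f Dir.right i ≠ 0 := (mul_pos (hp i) (hf0 _ i)).ne'
    have : u (i + 1) = (u i - q i * f Dir.left i * u (i - 1)) / (p i * f Dir.right i) := by
      rw [← hpair i]; rfl
    rw [this, mul_div_cancel₀ _ h0]
    ring
  set m : ℕ → ℝ≥0∞ :=
    fun i => ENNReal.ofReal (p i * t Dir.right i + q i * t Dir.left i) with hm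
  have hmn : ∀ i, 0 ≤ p i * t Dir.right i + q i * t Dir.left i := fun i =>
    add_nonneg (mul_nonneg (hp i).le (ht _ i)) (mul_nonneg (hqn i) (ht _ i))
  -- Since `u ≥ 1`, the loss `1 - f ≥ γ t` feeds the increments of `u`. They satisfy the recursion
  -- of `upMean` with `≥`, so they dominate `γ` times `upMean`.
  have hinc : ∀ i, q i * (u i - u (i - 1)) + γ * (p i * t Dir.right i + q i * t Dir.left i) ≤
      p i * (u (i + 1) - u i) := by
    intro i
    have h1 : γ * t Dir.right i ≤ (1 - f Dir.right i) * u (i + 1) := by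
      have a1 : γ * t Dir.right i ≤ 1 - f Dir.right i := by linarith [hf Dir.right i]
      have a2 : 0 ≤ 1 - f Dir.right i := by linarith [hf1 Dir.right i]
      nlinarith [hu1 (i + 1)]
    have h2 : γ * t Dir.left i ≤ (1 - f Dir.left i) * u (i - 1) := by
      have a1 : γ * t Dir.left i ≤ 1 - f Dir.left i := by linarith [hf Dir.left i]
      have a2 : 0 ≤ 1 - f Dir.left i := by linarith [hf1 Dir.left i]
      nlinarith [hu1 (i - 1)]
    have h3 := mul_le_mul_of_nonneg_left h1 (hp i).le
    have h4 := mul_le_mul_of_nonneg_left h2 (hqn i)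
    have h5 := heq i
    have h6 : p i * u i + q i * u i = u i := by rw [← add_mul, hpq, one_mul]
    nlinarith
  have hD : ∀ i, ENNReal.ofReal γ * upMean p q m i ≤ ENNReal.ofReal (u (i + 1) - u i) := by
    intro i
    have hcancel : ∀ i, ENNReal.ofReal (p i) * (ENNReal.ofReal γ * upMean p q m i) ≤
        ENNReal.ofReal (p i) * ENNReal.ofReal (u (i + 1) - u i) →
        ENNReal.ofReal γ * upMean p q m i ≤ ENNReal.ofReal (u (i + 1) - u i) := fun i h =>
      (ENNReal.mul_le_mul_iff_right (ENNReal.ofReal_pos.2 (hp i)).ne' ENNReal.ofReal_ne_top).1 h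
    induction i with
    | zero =>
      apply hcancel
      rw [mul_left_comm, upMean_rec hp hq0 hq, hq0, ENNReal.ofReal_zero, zero_mul, zero_add,
        ← ENNReal.ofReal_mul (hp 0).le, hm, ← ENNReal.ofReal_mul hγ.le]
      refine ENNReal.ofReal_le_ofReal ?_
      have := hinc 0
      rw [hq0] at this ⊢
      linarith
    | succ i ih =>
      apply hcancel
      have h0 : 0 ≤ u (i + 1) - u i := sub_nonneg.2 (hstep i)
      rw [mul_left_comm, upMean_rec hp hq0 hq, Nat.add_sub_cancel, mul_add, mul_left_comm]
      refine (add_le_add_left (mul_le_mul_right ih _) _).trans ?_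
      rw [hm, ← ENNReal.ofReal_mul hγ.le, ← ENNReal.ofReal_mul (hqn _),
        ← ENNReal.ofReal_mul (hp _).le,
        ← ENNReal.ofReal_add (mul_nonneg (hqn _) h0) (mul_nonneg hγ.le (hmn _))]
      exact ENNReal.ofReal_le_ofReal (hinc (i + 1))
  have hsum : ∀ n, ∑ i ∈ Finset.range n, ENNReal.ofReal γ * upMean p q m i ≤
      ENNReal.ofReal (u n) := by
    intro n
    refine (Finset.sum_le_sum fun i _ => hD i).trans ?_
    rw [← ENNReal.ofReal_sum_of_nonneg fun i _ => sub_nonneg.2 (hstep i), Finset.sum_range_sub]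
    exact ENNReal.ofReal_le_ofReal (by linarith [hupos 0])
  refine ⟨fun i => ENNReal.ofReal (u i), fun i => (ENNReal.ofReal_pos.2 (hupos i)).ne',
    fun i => ENNReal.ofReal_ne_top, ?_, fun i => ?_⟩
  · have h1 := ENNReal.tendsto_nat_tsum fun i => ENNReal.ofReal γ * upMean p q m i
    rw [ENNReal.tsum_mul_left, hE, ENNReal.mul_top (ENNReal.ofReal_pos.2 hγ).ne'] at h1
    exact tendsto_nhds_top_mono' h1 hsum
  · dsimp only
    rw [← ENNReal.ofReal_mul (hf0 _ i).le, ← ENNReal.ofReal_mul (hf0 _ i).le,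
      ← ENNReal.ofReal_mul (hp i).le, ← ENNReal.ofReal_mul (hqn i),
      ← ENNReal.ofReal_add
        (mul_nonneg (hp i).le (mul_nonneg (hf0 _ i).le (hupos _).le))
        (mul_nonneg (hqn i) (mul_nonneg (hf0 _ i).le (hupos _).le)), ← mul_assoc, ← mul_assoc]
    exact ENNReal.ofReal_le_ofReal (heq i).le

/-- The continued fraction of depth `N` for the ratio `u i / u (i - 1)` of the values of the
decreasing solution of `u i = p i * f⁺ i * u (i + 1) + q i * f⁻ i * u (i - 1)`. -/
noncomputable def ratioApprox (p q : ℕ → ℝ) (f : Dir → ℕ → ℝ) : ℕ → ℕ → ℝ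
  | 0, _ => 1
  | N + 1, i => q i * f Dir.left i / (1 - p i * f Dir.right i * ratioApprox p q f N (i + 1))

/-- Existence of the ratios of the decreasing solution. -/
theorem exists_ratio (hp : ∀ i, 0 < p i) (hq : ∀ i, 1 ≤ i → 0 < q i)
    (hpq : ∀ i, p i + q i = 1) (hf0 : ∀ s i, 0 < f s i) (hf1 : ∀ s i, f s i ≤ 1) :
    ∃ r : ℕ → ℝ, ∀ i, 1 ≤ i → 0 < r i ∧ r i ≤ 1 ∧
      r i * (1 - p i * f Dir.right i * r (i + 1)) = q i * f Dir.left i := by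
  -- Denominators stay at least `q i > 0`, which keeps the approximants in `(0, 1]`. They decrease
  -- with the depth, and their limits solve the fixed-point equation.
  have hden : ∀ i, 1 ≤ i → ∀ y, y ≤ 1 → q i ≤ 1 - p i * f Dir.right i * y := by
    intro i _ y hy1
    have h1 : f Dir.right i * y ≤ 1 :=
      (mul_le_of_le_one_right (hf0 _ i).le hy1).trans (hf1 _ i)
    have h2 := mul_le_mul_of_nonneg_left h1 (hp i).le
    have h3 := hpq i
    rw [mul_assoc]
    linarith
  have hnum : ∀ i, 1 ≤ i → 0 < q i * f Dir.left i := fun i hi => mul_pos (hq i hi) (hf0 _ i)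
  have hR : ∀ N i, 1 ≤ i → 0 < ratioApprox p q f N i ∧ ratioApprox p q f N i ≤ 1 := by
    intro N
    induction N with
    | zero => intro i _; simp [ratioApprox]
    | succ N ih =>
      intro i hi
      have hd := hden i hi _ (ih (i + 1) (by omega)).2
      have hqi := hq i hi
      rw [ratioApprox]
      refine ⟨div_pos (hnum i hi) (by linarith), (div_le_one (by linarith)).2 ?_⟩
      exact (mul_le_of_le_one_right hqi.le (hf1 _ i)).trans hd
  have hanti : ∀ N i, 1 ≤ i → ratioApprox p q f (N + 1) i ≤ ratioApprox p q f N i := by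
    intro N
    induction N with
    | zero => intro i hi; exact (hR 1 i hi).2
    | succ N ih =>
      intro i hi
      have hd := hden i hi _ (hR N (i + 1) (by omega)).2
      have hqi := hq i hi
      rw [ratioApprox, ratioApprox.eq_2 p q f i N]
      refine div_le_div_of_nonneg_left (hnum i hi).le (by linarith) ?_
      have := mul_le_mul_of_nonneg_left (ih (i + 1) (by omega))
        (mul_pos (hp i) (hf0 Dir.right i)).le
      linarith
  have hlim : ∀ i, 1 ≤ i → Tendsto (fun N => ratioApprox p q f N i) atTop
      (𝓝 (⨅ N, ratioApprox p q f N i)) := fun i hi =>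
    tendsto_atTop_ciInf (antitone_nat_of_succ_le fun N => hanti N i hi)
      ⟨0, by rintro _ ⟨N, rfl⟩; exact (hR N i hi).1.le⟩
  refine ⟨fun i => ⨅ N, ratioApprox p q f N i, fun i hi => ?_⟩
  have hle1 : ∀ i, 1 ≤ i → ⨅ N, ratioApprox p q f N i ≤ 1 := fun i hi =>
    le_of_tendsto' (hlim i hi) fun N => (hR N i hi).2
  have hd := hden i hi _ (hle1 (i + 1) (by omega))
  have hqi := hq i hi
  have heq : ⨅ N, ratioApprox p q f N i =
      q i * f Dir.left i / (1 - p i * f Dir.right i * ⨅ N, ratioApprox p q f N (i + 1)) := by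
    refine tendsto_nhds_unique ((tendsto_add_atTop_iff_nat 1).2 (hlim i hi)) ?_
    exact tendsto_const_nhds.div (tendsto_const_nhds.sub
      (tendsto_const_nhds.mul (hlim (i + 1) (by omega)))) (by linarith)
  refine ⟨?_, hle1 i hi, ?_⟩ <;> dsimp only
  · rw [heq]; exact div_pos (hnum i hi) (by linarith)
  · rw [heq]; exact div_mul_cancel₀ _ (by linarith)

/-- The product of the ratios is a decreasing solution with limit ℓ. Its decrements dominate `γ * ℓ`
times `downMean` and sum to at most `u 0 = 1`, so divergence forces ℓ = 0. -/
theorem exists_superharmonic_of_downMean (hp : ∀ i, 0 < p i)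
    (hq : ∀ i, 1 ≤ i → 0 < q i) (hpq : ∀ i, p i + q i = 1) (hγ : 0 < γ)
    (hf0 : ∀ s i, 0 < f s i) (ht : ∀ s i, 0 ≤ t s i) (hf : ∀ s i, f s i ≤ 1 - γ * t s i)
    (hI : ∑' n, downMean p q
      (fun i => ENNReal.ofReal (p i * t Dir.right i + q i * t Dir.left i)) n = ⊤) :
    ∃ u : ℕ → ℝ, (∀ i, 0 < u i) ∧ Tendsto u atTop (𝓝 0) ∧
      ∀ i, p (i + 1) * (f Dir.right (i + 1) * u (i + 2)) +
        q (i + 1) * (f Dir.left (i + 1) * u i) ≤ u (i + 1) := by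
  have hf1 : ∀ s i, f s i ≤ 1 := fun s i =>
    (hf s i).trans (by have := mul_nonneg hγ.le (ht s i); linarith)
  obtain ⟨r, hr⟩ := exists_ratio hp hq hpq hf0 hf1
  set u : ℕ → ℝ := fun i => ∏ j ∈ Finset.range i, r (j + 1) with hu
  have hus : ∀ i, u (i + 1) = u i * r (i + 1) := fun i => Finset.prod_range_succ _ _
  have hupos : ∀ i, 0 < u i := fun i => Finset.prod_pos fun j _ => (hr (j + 1) (by omega)).1
  have hanti : Antitone u := antitone_nat_of_succ_le fun i => by
    rw [hus]; exact mul_le_of_le_one_right (hupos i).le (hr (i + 1) (by omega)).2.1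
  have heq : ∀ i, p (i + 1) * (f Dir.right (i + 1) * u (i + 2)) +
      q (i + 1) * (f Dir.left (i + 1) * u i) = u (i + 1) := by
    intro i
    have := (hr (i + 1) (by omega)).2.2
    rw [hus (i + 1), hus i]
    linear_combination (-u i) * this
  have hbdd : BddBelow (Set.range u) := ⟨0, by rintro _ ⟨N, rfl⟩; exact (hupos N).le⟩
  have hlim := tendsto_atTop_ciInf hanti hbdd
  set ℓ := ⨅ i, u i with hℓ
  have hℓ0 : 0 ≤ ℓ := le_ciInf fun i => (hupos i).le
  have hℓu : ∀ i, ℓ ≤ u i := fun i => ciInf_le hbdd i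
  have hmn : ∀ i, 0 ≤ p (i + 1) * t Dir.right (i + 1) + q (i + 1) * t Dir.left (i + 1) := fun i =>
    add_nonneg (mul_nonneg (hp _).le (ht _ _)) (mul_nonneg (hq _ (by omega)).le (ht _ _))
  have hinc : ∀ k, γ * ℓ * (p (k + 1) * t Dir.right (k + 1) + q (k + 1) * t Dir.left (k + 1)) +
      p (k + 1) * (u (k + 1) - u (k + 2)) ≤ q (k + 1) * (u k - u (k + 1)) := by
    intro k
    have hb : ∀ s j, γ * t s (k + 1) * ℓ ≤ (1 - f s (k + 1)) * u j := fun s j =>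
      mul_le_mul (by linarith [hf s (k + 1)]) (hℓu j) hℓ0 (by linarith [hf1 s (k + 1)])
    have h3 := mul_le_mul_of_nonneg_left (hb Dir.right (k + 2)) (hp (k + 1)).le
    have h4 := mul_le_mul_of_nonneg_left (hb Dir.left k) (hq (k + 1) (by omega)).le
    have h5 := heq k
    have h6 : p (k + 1) * u (k + 1) + q (k + 1) * u (k + 1) = u (k + 1) := by
      rw [← add_mul, hpq, one_mul]
    nlinarith
  set m : ℕ → ℝ≥0∞ :=
    fun i => ENNReal.ofReal (p i * t Dir.right i + q i * t Dir.left i) with hm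
  have hdk : ∀ k, 0 ≤ u k - u (k + 1) := fun k => sub_nonneg.2 (hanti (Nat.le_succ k))
  -- The recursion for `downMean` refers to `k + 1` and has no base case, so the induction runs on
  -- the length of the partial sum.
  have hpart : ∀ N k, ENNReal.ofReal (γ * ℓ) *
      ∑ j ∈ Finset.range N, m (k + 1 + j) * downKernel p q k (k + 1 + j) ≤
      ENNReal.ofReal (u k - u (k + 1)) := by
    intro N
    induction N with
    | zero => intro k; simp
    | succ N ih =>
      intro k
      have hqk := hq (k + 1) (by omega)
      refine (ENNReal.mul_le_mul_iff_right (ENNReal.ofReal_pos.2 hqk).ne'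
        ENNReal.ofReal_ne_top).1 ?_
      have e : ENNReal.ofReal (q (k + 1)) *
          ∑ j ∈ Finset.range (N + 1), m (k + 1 + j) * downKernel p q k (k + 1 + j) =
          m (k + 1) + ENNReal.ofReal (p (k + 1)) *
          ∑ j ∈ Finset.range N, m (k + 1 + 1 + j) * downKernel p q (k + 1) (k + 1 + 1 + j) := by
        rw [Finset.sum_range_succ', add_comm (Finset.sum _ _), mul_add, add_zero, mul_left_comm,
          downKernel_self hq, mul_one, Finset.mul_sum, Finset.mul_sum]
        congr 1
        refine Finset.sum_congr rfl fun j _ => ?_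
        rw [show k + 1 + (j + 1) = k + 1 + 1 + j by omega, mul_left_comm,
          downKernel_succ hp hq (by omega), mul_left_comm]
      rw [mul_left_comm, e, mul_add, mul_left_comm]
      refine (add_le_add_right (mul_le_mul_right (ih (k + 1)) _) _).trans ?_
      rw [hm, ← ENNReal.ofReal_mul (mul_nonneg hγ.le hℓ0), ← ENNReal.ofReal_mul (hp _).le,
        ← ENNReal.ofReal_mul hqk.le,
        ← ENNReal.ofReal_add (mul_nonneg (mul_nonneg hγ.le hℓ0) (hmn k))
          (mul_nonneg (hp _).le (hdk _))]
      exact ENNReal.ofReal_le_ofReal (hinc k)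
  have hD : ∀ k, ENNReal.ofReal (γ * ℓ) * downMean p q m k ≤ ENNReal.ofReal (u k - u (k + 1)) := by
    intro k
    rw [downMean, ← ENNReal.tsum_mul_left]
    refine ENNReal.tsum_le_of_sum_range_le fun N => ?_
    rw [← Finset.mul_sum]
    exact hpart N k
  have hsum : ENNReal.ofReal (γ * ℓ) * ∑' k, downMean p q m k ≤ 1 := by
    rw [← ENNReal.tsum_mul_left]
    refine ENNReal.tsum_le_of_sum_range_le fun N => (Finset.sum_le_sum fun k _ => hD k).trans ?_
    rw [← ENNReal.ofReal_sum_of_nonneg fun i _ => hdk i, Finset.sum_range_sub',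
      ← ENNReal.ofReal_one]
    refine ENNReal.ofReal_le_ofReal ?_
    have : u 0 = 1 := by simp [hu]
    linarith [hupos N]
  have hℓz : ℓ = 0 := by
    by_contra hne
    have hpos : 0 < γ * ℓ := mul_pos hγ (lt_of_le_of_ne hℓ0 (Ne.symm hne))
    rw [hI, ENNReal.mul_top (ENNReal.ofReal_pos.2 hpos).ne'] at hsum
    exact absurd hsum (by simp)
  rw [hℓz] at hlim
  exact ⟨u, hupos, hlim, fun i => (heq i).le⟩

/-- The tail sums of `δ` are harmonic for the embedded chain at positive states, and factors `f ≤ 1`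
only help. -/
theorem exists_superharmonic_of_delta (hp : ∀ i, 0 < p i)
    (hq : ∀ i, 1 ≤ i → 0 < q i) (hpq : ∀ i, p i + q i = 1)
    (hf1 : ∀ s i, f s i ≤ 1) (hδ : deltaSeries p q < ⊤) :
    ∃ u : ℕ → ℝ, (∀ i, 0 < u i) ∧ Tendsto u atTop (𝓝 0) ∧
      ∀ i, p (i + 1) * (f Dir.right (i + 1) * u (i + 2)) +
        q (i + 1) * (f Dir.left (i + 1) * u i) ≤ u (i + 1) := by
  have hs : Summable (delta p q) := by
    have := ENNReal.summable_toReal hδ.ne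
    simpa only [ENNReal.toReal_ofReal (delta_pos hp hq _).le] using this
  set u : ℕ → ℝ := fun i => ∑' k, delta p q (k + i) with hu
  have hsi : ∀ i, Summable fun k => delta p q (k + i) := fun i => (summable_nat_add_iff i).2 hs
  have hus : ∀ i, u i = delta p q i + u (i + 1) := by
    intro i
    rw [hu]
    dsimp only
    rw [(hsi i).tsum_eq_zero_add, zero_add]
    congr 1
    exact tsum_congr fun k => by rw [add_right_comm, add_assoc]
  have hupos : ∀ i, 0 < u i := fun i =>
    (hsi i).tsum_pos (fun k => (delta_pos hp hq _).le) 0 (delta_pos hp hq _)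
  refine ⟨u, hupos, tendsto_sum_nat_add _, fun i => ?_⟩
  have h1 := hus i
  have h2 := hus (i + 1)
  have h3 := delta_succ (p := p) (q := q) hp i
  have h4 : p (i + 1) * (f Dir.right (i + 1) * u (i + 2)) ≤ p (i + 1) * u (i + 2) :=
    mul_le_mul_of_nonneg_left (mul_le_of_le_one_left (hupos _).le (hf1 _ _)) (hp _).le
  have h5 : q (i + 1) * (f Dir.left (i + 1) * u i) ≤ q (i + 1) * u i :=
    mul_le_mul_of_nonneg_left (mul_le_of_le_one_left (hupos _).le (hf1 _ _)) (hq _ (by omega)).le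
  have h6 : p (i + 1) * u (i + 1) + q (i + 1) * u (i + 1) = u (i + 1) := by
    rw [← add_mul, hpq, one_mul]
  have h7 : u (i + 2) = u (i + 1) - delta p q (i + 1) := by linarith
  rw [h7] at h4 ⊢
  rw [h1] at h5 ⊢
  nlinarith

/-- The function that shows the absence of implosion. -/
theorem exists_superharmonic_tendsto_zero (hp : ∀ i, 0 < p i)
    (hq : ∀ i, 1 ≤ i → 0 < q i) (hpq : ∀ i, p i + q i = 1) (hγ : 0 < γ)
    (hf0 : ∀ s i, 0 < f s i) (ht : ∀ s i, 0 ≤ t s i) (hf : ∀ s i, f s i ≤ 1 - γ * t s i)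
    (h : ∑' n, downMean p q
      (fun i => ENNReal.ofReal (p i * t Dir.right i + q i * t Dir.left i)) n = ⊤ ∨
      deltaSeries p q < ⊤) :
    ∃ u : ℕ → ℝ≥0∞, (∀ i, u i ≠ 0) ∧ Tendsto u atTop (𝓝 0) ∧
      ∀ i, 1 ≤ i → ENNReal.ofReal (p i) * (ENNReal.ofReal (f Dir.right i) * u (i + 1)) +
        ENNReal.ofReal (q i) * (ENNReal.ofReal (f Dir.left i) * u (i - 1)) ≤ u i := by
  have hf1 : ∀ s i, f s i ≤ 1 := fun s i =>
    (hf s i).trans (by have := mul_nonneg hγ.le (ht s i); linarith)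
  obtain ⟨u, hupos, hlim, hu⟩ : ∃ u : ℕ → ℝ, (∀ i, 0 < u i) ∧ Tendsto u atTop (𝓝 0) ∧
      ∀ i, p (i + 1) * (f Dir.right (i + 1) * u (i + 2)) +
        q (i + 1) * (f Dir.left (i + 1) * u i) ≤ u (i + 1) := by
    rcases h with h | h
    · exact exists_superharmonic_of_downMean hp hq hpq hγ hf0 ht hf h
    · exact exists_superharmonic_of_delta hp hq hpq hf1 h
  refine ⟨fun i => ENNReal.ofReal (u i), fun i => (ENNReal.ofReal_pos.2 (hupos i)).ne',
    ?_, fun i hi => ?_⟩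
  · rw [← ENNReal.ofReal_zero]; exact ENNReal.tendsto_ofReal hlim
  · obtain ⟨i, rfl⟩ : ∃ j, i = j + 1 := ⟨i - 1, by omega⟩
    have hqi := hq (i + 1) (by omega)
    dsimp only
    rw [Nat.add_sub_cancel, ← ENNReal.ofReal_mul (hf0 _ _).le, ← ENNReal.ofReal_mul (hf0 _ _).le,
      ← ENNReal.ofReal_mul (hp _).le, ← ENNReal.ofReal_mul hqi.le,
      ← ENNReal.ofReal_add
        (mul_nonneg (hp _).le (mul_nonneg (hf0 _ _).le (hupos _).le))
        (mul_nonneg hqi.le (mul_nonneg (hf0 _ _).le (hupos _).le))]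
    exact ENNReal.ofReal_le_ofReal (hu i)

end Laplace

/-! ### Products of exponentials, a dominated limit, and the zero-one alternative. -/

theorem expNeg_add (s t : ℝ≥0∞) : expNeg (s + t) = expNeg s * expNeg t := by
  rcases eq_or_ne s ⊤ with rfl | hs
  · simp [expNeg_top]
  rcases eq_or_ne t ⊤ with rfl | ht
  · simp [expNeg_top]
  rw [← ENNReal.ofReal_toReal hs, ← ENNReal.ofReal_toReal ht,
    ← ENNReal.ofReal_add ENNReal.toReal_nonneg ENNReal.toReal_nonneg,
    expNeg_ofReal ENNReal.toReal_nonneg, expNeg_ofReal ENNReal.toReal_nonneg,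
    expNeg_ofReal (by positivity), ← ENNReal.ofReal_mul (Real.exp_pos _).le, ← Real.exp_add]
  congr 2
  ring

theorem expNeg_sum {ι : Type*} (s : Finset ι) (x : ι → ℝ≥0∞) :
    expNeg (∑ i ∈ s, x i) = ∏ i ∈ s, expNeg (x i) := by
  classical
  induction s using Finset.induction_on with
  | empty => simp [expNeg]
  | insert i s hi ih => rw [Finset.sum_insert hi, Finset.prod_insert hi, expNeg_add, ih]

/-- Dominated convergence for the counting measure on pairs `(k, j)`. -/
theorem tendsto_tsum_downMean {p q : ℕ → ℝ} {c : ℝ → ℕ → ℝ≥0∞} {b : ℕ → ℝ≥0∞}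
    (hb : ∑' k, downMean p q b k ≠ ⊤) (hcb : ∀ᶠ C in atTop, ∀ i, c C i ≤ b i)
    (hc : ∀ i, Tendsto (fun C => c C i) atTop (𝓝 0)) :
    Tendsto (fun C => ∑' k, downMean p q (c C) k) atTop (𝓝 0) := by
  have e : ∀ m : ℕ → ℝ≥0∞, ∑' k, downMean p q m k =
      ∫⁻ z : ℕ × ℕ, m (z.1 + 1 + z.2) * downKernel p q z.1 (z.1 + 1 + z.2) ∂Measure.count := by
    intro m
    rw [lintegral_count]
    simp only [downMean]
    exact (ENNReal.tsum_prod (f := fun k j => m (k + 1 + j) * downKernel p q k (k + 1 + j))).symm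
  simp_rw [e] at hb ⊢
  have := tendsto_lintegral_filter_of_dominated_convergence
    (μ := (Measure.count : Measure (ℕ × ℕ))) (l := atTop)
    (F := fun (C : ℝ) (z : ℕ × ℕ) =>
      c C (z.1 + 1 + z.2) * downKernel p q z.1 (z.1 + 1 + z.2)) (f := fun _ => 0)
    (fun z => b (z.1 + 1 + z.2) * downKernel p q z.1 (z.1 + 1 + z.2))
    (Eventually.of_forall fun C => measurable_of_countable _)
    (hcb.mono fun C hC => Eventually.of_forall fun z => mul_le_mul_left (hC _) _) hb
    (Eventually.of_forall fun z => by
      have := ENNReal.Tendsto.mul_const (hc (z.1 + 1 + z.2))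
        (b := downKernel p q z.1 (z.1 + 1 + z.2)) (Or.inr ENNReal.ofReal_ne_top)
      rwa [zero_mul] at this)
  simpa using this

theorem measure_dichotomy {Ω : Type*} [MeasurableSpace Ω] {μ : Measure Ω} [IsProbabilityMeasure μ]
    {P : Ω → Prop} {c : Prop} (h1 : c → ∀ᵐ ω ∂μ, P ω) (h0 : ¬c → ∀ᵐ ω ∂μ, ¬P ω) :
    (μ {ω | P ω} = 1 ↔ c) ∧ (μ {ω | P ω} = 0 ↔ ¬c) := by
  by_cases hc : c
  · have : μ {ω | P ω} = 1 := by
      rw [← measure_univ (μ := μ)]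
      refine measure_congr ?_
      filter_upwards [h1 hc] with ω hω
      exact propext ⟨fun _ => trivial, fun _ => hω⟩
    simp [this, hc]
  · have : μ {ω | P ω} = 0 := by
      have := h0 hc
      rw [ae_iff] at this
      simpa using this
    simp [this, hc]

/-! ### Walks from a fixed state. -/

namespace WalkData

variable {Ω : Type*} [MeasurableSpace Ω] {p q : ℕ → ℝ} {W : ℕ → Dir → Measure ℝ} {μ : Measure Ω}
  {D : WalkData Ω}

theorem IsWalkFrom.lintegral_comp_X [IsProbabilityMeasure μ] {i : ℕ}
    (hD : D.IsWalkFrom p q W μ i) (v : ℕ → ℝ≥0∞) : ∫⁻ ω, v (D.X 0 ω) ∂μ = v i := by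
  have : ∫⁻ ω, v (D.X 0 ω) ∂μ = ∫⁻ _, v i ∂μ :=
    lintegral_congr_ae (hD.2.mono fun ω hω => by simp only [hω])
  simpa using this

theorem IsWalkFrom.ae_hits [IsProbabilityMeasure μ] (hWp : ∀ i s, IsProbabilityMeasure (W i s))
    (hp : ∀ i, 0 < p i) (hq0 : q 0 = 0) (hq : ∀ i, 1 ≤ i → 0 < q i) (hpq : ∀ i, p i + q i = 1)
    {b : ℕ → ℝ≥0∞} (hb : ∀ i, b i ≠ 0) (hI : ∑' k, downMean p q b k ≠ ⊤)
    (hδ : deltaSeries p q = ⊤) {i n : ℕ} (hD : D.IsWalkFrom p q W μ i) (hni : n ≤ i) :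
    ∀ᵐ ω ∂μ, ∃ k, D.X k ω = n := by
  refine hD.1.ae_hits hWp hq0 n b (potential (downMean p q b) n)
    (potential (fun k => ENNReal.ofReal (delta p q k)) n) hb
    (potential_superharmonic hp hq hpq (downMean_rec hp hq b) n) (fun j hj => ?_) ?_ ?_
    (tendsto_potential (fun _ => ENNReal.ofReal_ne_top) hδ n)
  · have := potential_superharmonic hp hq hpq (m := fun _ => 0)
      (d := fun k => ENNReal.ofReal (delta p q k)) (fun k => by
        rw [zero_add, ← ENNReal.ofReal_mul (hq _ (by omega)).le, ← ENNReal.ofReal_mul (hp _).le,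
          delta_succ hp]) n j hj
    rwa [zero_add] at this
  · rw [hD.lintegral_comp_X]
    exact ne_top_of_le_ne_top hI (potential_le_tsum _ hni)
  · rw [hD.lintegral_comp_X, potential, if_neg (not_lt.2 hni)]
    exact ENNReal.sum_ne_top.2 fun _ _ => ENNReal.ofReal_ne_top

/-- Replacing `u` by `⊤` below `n` confines the inequality to states above `n`, all of them at least
1. -/
theorem IsWalkFrom.lintegral_expNeg_hitTime_le [IsProbabilityMeasure μ] (hq0 : q 0 = 0)
    {u : ℕ → ℝ≥0∞}
    (hu : ∀ i, 1 ≤ i → ENNReal.ofReal (p i) *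
      ((∫⁻ t, ENNReal.ofReal (Real.exp (-t)) ∂(W i Dir.right)) * u (i + 1)) +
      ENNReal.ofReal (q i) * ((∫⁻ t, ENNReal.ofReal (Real.exp (-t)) ∂(W i Dir.left)) * u (i - 1))
        ≤ u i) {i n : ℕ} (hD : D.IsWalkFrom p q W μ i) (hni : n ≤ i) :
    (∫⁻ ω, expNeg (D.hitTime n ω) ∂μ) * u n ≤ u i := by
  have := hD.1.lintegral_expNeg_hitTime_le hq0 (fun _ => 1) (fun j => if j < n then ⊤ else u j) n
    (by
      intro j hj
      rcases lt_or_gt_of_ne hj with h | h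
      · rw [if_pos h]; exact le_top
      · rw [if_neg (by omega), if_neg (by omega), if_neg (by omega)]
        exact hu j (by omega))
  simp only [one_mul] at this
  rw [hD.lintegral_comp_X (fun j => if j < n then ⊤ else u j), if_neg (lt_irrefl n),
    if_neg (not_lt.2 hni)] at this
  exact this

end WalkData

/-! ### Implosion: uniform tails and the time from infinity. -/

section Implosion

open WalkData

variable {p q : ℕ → ℝ} {W : ℕ → Dir → Measure ℝ}

theorem tendsto_iSup_hitTime (hWp : ∀ i s, IsProbabilityMeasure (W i s))
    (hp : ∀ i, 0 < p i) (hq0 : q 0 = 0) (hq : ∀ i, 1 ≤ i → 0 < q i) (hpq : ∀ i, p i + q i = 1)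
    (hb : ∀ i, stepMean p q W (fun t => min (ENNReal.ofReal t) 1) i ≠ 0)
    (hI : ∑' k, downMean p q (stepMean p q W (fun t => min (ENNReal.ofReal t) 1)) k ≠ ⊤)
    (hδ : deltaSeries p q = ⊤) {Ω : ℕ → Type*} [∀ i, MeasurableSpace (Ω i)]
    (P : ∀ i, Measure (Ω i)) [∀ i, IsProbabilityMeasure (P i)] (D : ∀ i, WalkData (Ω i))
    (hD : ∀ i, (D i).IsWalkFrom p q W (P i) i) :
    Tendsto (fun C : ℝ => ⨆ i, P i {ω | ENNReal.ofReal C < (D i).hitTime 0 ω}) atTop (𝓝 0) := by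
  refine tendsto_of_tendsto_of_tendsto_of_le_of_le' tendsto_const_nhds
    (tendsto_tsum_downMean hI
      ((eventually_ge_atTop 1).mono fun C hC i => stepMean_mono (truncation_le hC) i)
      (tendsto_stepMean_truncation hWp)) (Eventually.of_forall fun _ => zero_le) ?_
  filter_upwards [eventually_gt_atTop 0] with C hC
  refine iSup_le fun i => ?_
  have := (hD i).1.measure_lt_hitTime_le hWp hq0 0 hC
    (potential (downMean p q (stepMean p q W fun t => min (ENNReal.ofReal (t / C)) 1)) 0)
    (potential_superharmonic hp hq hpq (downMean_rec hp hq _) 0)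
    ((hD i).ae_hits hWp hp hq0 hq hpq hb hI hδ (Nat.zero_le i))
  rw [(hD i).lintegral_comp_X] at this
  exact this.trans (potential_le_tsum _ (Nat.zero_le i))

theorem not_tendsto_iSup_hitTime (hq0 : q 0 = 0) {u : ℕ → ℝ≥0∞} (hu0 : ∀ i, u i ≠ 0)
    (hlim : Tendsto u atTop (𝓝 0))
    (hu : ∀ i, 1 ≤ i → ENNReal.ofReal (p i) *
      ((∫⁻ t, ENNReal.ofReal (Real.exp (-t)) ∂(W i Dir.right)) * u (i + 1)) +
      ENNReal.ofReal (q i) * ((∫⁻ t, ENNReal.ofReal (Real.exp (-t)) ∂(W i Dir.left)) * u (i - 1))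
        ≤ u i) {Ω : ℕ → Type*} [∀ i, MeasurableSpace (Ω i)]
    (P : ∀ i, Measure (Ω i)) [∀ i, IsProbabilityMeasure (P i)] (D : ∀ i, WalkData (Ω i))
    (hD : ∀ i, (D i).IsWalkFrom p q W (P i) i) :
    ¬ Tendsto (fun C : ℝ => ⨆ i, P i {ω | ENNReal.ofReal C < (D i).hitTime 0 ω})
      atTop (𝓝 0) := by
  intro h
  obtain ⟨C, hC⟩ := (h.eventually (gt_mem_nhds (show (0 : ℝ≥0∞) < 2⁻¹ by simp))).exists
  -- Uniformly in `i`, `σ_0 ≤ C` has probability at least `1 / 2`. This keeps the Laplace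
  -- transforms, hence `u`, away from 0.
  have hlow : ∀ i, expNeg (ENNReal.ofReal C) * 2⁻¹ * u 0 ≤ u i := by
    intro i
    refine le_trans ?_ ((hD i).lintegral_expNeg_hitTime_le hq0 hu (Nat.zero_le i))
    refine mul_le_mul_left ?_ _
    have hmeas : MeasurableSet {ω | (D i).hitTime 0 ω ≤ ENNReal.ofReal C} :=
      measurableSet_le ((hD i).1.measurable_hitTime 0) measurable_const
    have h1 : 2⁻¹ ≤ P i {ω | (D i).hitTime 0 ω ≤ ENNReal.ofReal C} := by
      have hlt : P i {ω | ENNReal.ofReal C < (D i).hitTime 0 ω} ≤ 2⁻¹ :=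
        (le_iSup (fun i => P i {ω | ENNReal.ofReal C < (D i).hitTime 0 ω}) i).trans hC.le
      have e : {ω | (D i).hitTime 0 ω ≤ ENNReal.ofReal C}ᶜ =
          {ω | ENNReal.ofReal C < (D i).hitTime 0 ω} := by
        ext ω; simp
      rw [← e, prob_compl_eq_one_sub hmeas] at hlt
      have h2 : 1 ≤ 2⁻¹ + P i {ω | (D i).hitTime 0 ω ≤ ENNReal.ofReal C} :=
        tsub_le_iff_right.1 hlt
      rw [← ENNReal.inv_two_add_inv_two] at h2
      exact (ENNReal.add_le_add_iff_left (by simp)).1 h2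
    refine (mul_le_mul_right h1 _).trans ?_
    rw [← setLIntegral_const]
    refine (setLIntegral_mono (measurable_expNeg.comp ((hD i).1.measurable_hitTime 0))
      fun ω hω => expNeg_antitone hω).trans (setLIntegral_le_lintegral _ _)
  have hz := ge_of_tendsto' hlim hlow
  have hpos : 0 < expNeg (ENNReal.ofReal C) * 2⁻¹ * u 0 :=
    ENNReal.mul_pos (mul_ne_zero (expNeg_pos ENNReal.ofReal_ne_top).ne' (by simp)) (hu0 0)
  exact absurd hz (not_le.2 hpos)

variable {Ω : Type*} [MeasurableSpace Ω] {μ : Measure Ω}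

theorem ae_implosionTime_lt_top [IsProbabilityMeasure μ]
    (hWp : ∀ i s, IsProbabilityMeasure (W i s))
    (hp : ∀ i, 0 < p i) (hq0 : q 0 = 0) (hq : ∀ i, 1 ≤ i → 0 < q i) (hpq : ∀ i, p i + q i = 1)
    (hb : ∀ i, stepMean p q W (fun t => min (ENNReal.ofReal t) 1) i ≠ 0)
    (hI : ∑' k, downMean p q (stepMean p q W (fun t => min (ENNReal.ofReal t) 1)) k ≠ ⊤)
    (hδ : deltaSeries p q = ⊤) (Y : ℕ → WalkData Ω) (hY : ∀ n, (Y n).IsWalkFrom p q W μ n) :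
    ∀ᵐ ω ∂μ, implosionTime Y ω < ⊤ := by
  set b := stepMean p q W (fun t => min (ENNReal.ofReal t) 1) with hbdef
  have hφ : Measurable fun t : ℝ => min (ENNReal.ofReal t) 1 := by fun_prop
  have hmt : ∀ n, Measurable fun ω => ∑' k, (Y (n + 1)).alive {n} k ω *
      min (ENNReal.ofReal ((Y (n + 1)).wait k ω)) 1 := by
    intro n
    have hm : ∀ k, Measurable fun ω => (Y (n + 1)).alive {n} k ω *
        min (ENNReal.ofReal ((Y (n + 1)).wait k ω)) 1 := fun k =>
      ((hY (n + 1)).1.measurable_alive {n} k).mul (hφ.comp ((hY (n + 1)).1.measurable_wait k))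
    exact Measurable.tsum hm
  have hle : ∀ n, ∫⁻ ω, ∑' k, (Y (n + 1)).alive {n} k ω *
      min (ENNReal.ofReal ((Y (n + 1)).wait k ω)) 1 ∂μ ≤ downMean p q b n := by
    intro n
    have := (hY (n + 1)).1.lintegral_tsum_alive_wait_le hWp hq0 {n} hφ
      (potential (downMean p q b) n)
      (potential_superharmonic hp hq hpq (downMean_rec hp hq _) n)
    rwa [(hY (n + 1)).lintegral_comp_X, potential_self_succ] at this
  have hfin : ∫⁻ ω, ∑' n, ∑' k, (Y (n + 1)).alive {n} k ω *
      min (ENNReal.ofReal ((Y (n + 1)).wait k ω)) 1 ∂μ ≠ ⊤ := by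
    rw [lintegral_tsum fun n => (hmt n).aemeasurable]
    exact ne_top_of_le_ne_top hI (ENNReal.tsum_le_tsum hle)
  have hhit : ∀ᵐ ω ∂μ, ∀ n, ∃ k, (Y (n + 1)).X k ω = n := ae_all_iff.2 fun n =>
    (hY (n + 1)).ae_hits hWp hp hq0 hq hpq hb hI hδ (Nat.le_succ n)
  filter_upwards [ae_lt_top (Measurable.tsum hmt) hfin, hhit] with ω h1 h2
  have e : ∀ n k, (Y (n + 1)).alive {n} k ω * min (ENNReal.ofReal ((Y (n + 1)).wait k ω)) 1 =
      min ((Y (n + 1)).alive {n} k ω * ENNReal.ofReal ((Y (n + 1)).wait k ω)) 1 := by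
    intro n k
    rw [alive]
    split_ifs <;> simp
  simp_rw [e] at h1
  -- Flattening to one sum over pairs lets the truncation be removed for all walks at once.
  rw [← ENNReal.tsum_prod (f := fun n k =>
    min ((Y (n + 1)).alive {n} k ω * ENNReal.ofReal ((Y (n + 1)).wait k ω)) 1)] at h1
  have h3 := tsum_ne_top_of_tsum_min_ne_top (x := fun z : ℕ × ℕ =>
    (Y (z.1 + 1)).alive {z.1} z.2 ω * ENNReal.ofReal ((Y (z.1 + 1)).wait z.2 ω)) (fun z => by
      rw [alive]; split_ifs <;> simp) h1.ne
  rw [ENNReal.tsum_prod (f := fun n k =>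
    (Y (n + 1)).alive {n} k ω * ENNReal.ofReal ((Y (n + 1)).wait k ω))] at h3
  have h4 : implosionTime Y ω = ∑' n, ∑' k,
      (Y (n + 1)).alive {n} k ω * ENNReal.ofReal ((Y (n + 1)).wait k ω) :=
    tsum_congr fun n => hitTime_eq_tsum_alive ((hY (n + 1)).1.wait_pos ω) (h2 n)
  rw [h4]
  exact h3.lt_top

theorem iIndepFun_expNeg_hitTime (Y : ℕ → WalkData Ω) (hY : ∀ n, (Y n).IsWalkFrom p q W μ n)
    (hind : iIndepFun (fun (n : ℕ) (ω : Ω) (t : ℝ≥0) => (Y n).walk t ω) μ) :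
    iIndepFun (fun (n : ℕ) (ω : Ω) => expNeg ((Y (n + 1)).hitTime n ω)) μ := by
  set g : ℕ → (ℝ≥0 → ℕ∞) → ℝ≥0∞ := fun n w => expNeg
    (⨅ r : ℚ≥0, if w (r : ℝ≥0) = (n : ℕ∞) then ((r : ℝ≥0) : ℝ≥0∞) else ⊤) with hg
  have hset : ∀ (n : ℕ) (r : ℚ≥0), MeasurableSet {w : ℝ≥0 → ℕ∞ | w (r : ℝ≥0) = (n : ℕ∞)} :=
    fun n r => (measurable_pi_apply (X := fun _ : ℝ≥0 => ℕ∞) (r : ℝ≥0))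
      (measurableSet_singleton (n : ℕ∞))
  have hgm : ∀ n, Measurable (g n) := fun n => measurable_expNeg.comp <|
    Measurable.iInf fun r => Measurable.ite (hset n r) measurable_const measurable_const
  have h1 := (hind.precomp (g := fun n : ℕ => n + 1) fun a b h => by simpa using h).comp g hgm
  have e : (fun (n : ℕ) (ω : Ω) => expNeg ((Y (n + 1)).hitTime n ω)) =
      fun n => g n ∘ fun ω t => (Y (n + 1)).walk t ω := by
    ext n ω
    simp only [hg, Function.comp_apply]
    rw [hitTime_eq_iInf_rat ((hY (n + 1)).1.wait_pos ω)]
    congr 1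
    refine iInf_congr fun r => ?_
    by_cases h : (Y (n + 1)).walk (r : ℝ≥0) ω = (n : ℕ∞) <;> simp [h]
  rw [e]
  exact h1

theorem ae_implosionTime_eq_top [IsProbabilityMeasure μ] (hq0 : q 0 = 0) {u : ℕ → ℝ≥0∞}
    (hu0 : ∀ i, u i ≠ 0) (hlim : Tendsto u atTop (𝓝 0))
    (hu : ∀ i, 1 ≤ i → ENNReal.ofReal (p i) *
      ((∫⁻ t, ENNReal.ofReal (Real.exp (-t)) ∂(W i Dir.right)) * u (i + 1)) +
      ENNReal.ofReal (q i) * ((∫⁻ t, ENNReal.ofReal (Real.exp (-t)) ∂(W i Dir.left)) * u (i - 1))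
        ≤ u i) (Y : ℕ → WalkData Ω) (hY : ∀ n, (Y n).IsWalkFrom p q W μ n)
    (hind : iIndepFun (fun (n : ℕ) (ω : Ω) (t : ℝ≥0) => (Y n).walk t ω) μ) :
    ∀ᵐ ω ∂μ, ¬ implosionTime Y ω < ⊤ := by
  have hm : ∀ n, Measurable fun ω => (Y (n + 1)).hitTime n ω := fun n =>
    (hY (n + 1)).1.measurable_hitTime n
  have hmρ : Measurable (implosionTime Y) := Measurable.tsum hm
  -- The passage from `N + 1` to `N` contributes at most `u (N + 1) / u N`, so the product
  -- telescopes.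
  have hprod : ∀ N, (∏ n ∈ Finset.range N, ∫⁻ ω, expNeg ((Y (n + 1)).hitTime n ω) ∂μ) * u 0 ≤
      u N := by
    intro N
    induction N with
    | zero => simp
    | succ N ih =>
      rw [Finset.prod_range_succ, mul_right_comm, mul_comm]
      exact (mul_le_mul_right ih _).trans
        ((hY (N + 1)).lintegral_expNeg_hitTime_le hq0 hu (Nat.le_succ N))
  have hle : ∀ N, (∫⁻ ω, expNeg (implosionTime Y ω) ∂μ) * u 0 ≤ u N := by
    intro N
    refine le_trans (mul_le_mul_left ?_ _) (hprod N)
    rw [← lintegral_prod_eq_prod_lintegral_of_indepFun (Finset.range N)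
      (fun n ω => expNeg ((Y (n + 1)).hitTime n ω)) (iIndepFun_expNeg_hitTime Y hY hind)
      (fun n => measurable_expNeg.comp (hm n))]
    refine lintegral_mono fun ω => ?_
    rw [← expNeg_sum]
    exact expNeg_antitone (ENNReal.sum_le_tsum _)
  have hz := le_antisymm (ge_of_tendsto' hlim hle) zero_le
  have hz' := (mul_eq_zero.1 hz).resolve_right (hu0 0)
  have hmε : Measurable fun ω => expNeg (implosionTime Y ω) := measurable_expNeg.comp hmρ
  rw [lintegral_eq_zero_iff hmε] at hz'
  filter_upwards [hz'] with ω hω hlt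
  exact (expNeg_pos hlt.ne).ne' hω

end Implosion

/-! ### Comparison with `meanTail` and conclusion. -/

theorem meanTail_eq {p q : ℕ → ℝ} (hpq : ∀ i, p i + q i = 1) (L : Dir → Measure ℝ)
    (a : Dir → ℕ → ℝ) (i : ℕ) :
    meanTail p q L a i = p i * (1 - cdf (L Dir.right) (a Dir.right i)) +
      q i * (1 - cdf (L Dir.left) (a Dir.left i)) := by
  rw [meanTail]
  linear_combination (-1 : ℝ) * hpq i

/-- The truncated mean waiting time is comparable with `meanTail`. -/
theorem exists_stepMean_le {p q : ℕ → ℝ} (hp : ∀ i, 0 < p i) (hq : ∀ i, 0 ≤ q i)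
    (hpq : ∀ i, p i + q i = 1) {L : Dir → Measure ℝ} (hLprob : ∀ s, IsProbabilityMeasure (L s))
    {α : Dir → ℝ} (hα1 : ∀ s, α s < 1)
    (hreg : ∀ s, RegularlyVarying (fun x => 1 - cdf (L s) x) (-α s))
    {a : Dir → ℕ → ℝ} (ha0 : ∀ s i, 0 < a s i)
    {W : ℕ → Dir → Measure ℝ} (hW : ∀ i s, W i s = (L s).map (fun x => x / a s i)) :
    (∀ i, ENNReal.ofReal (meanTail p q L a i) ≤
      stepMean p q W (fun t => min (ENNReal.ofReal t) 1) i) ∧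
    ∃ K : ℝ, ∀ i, stepMean p q W (fun t => min (ENNReal.ofReal t) 1) i ≤
      ENNReal.ofReal K * ENNReal.ofReal (meanTail p q L a i) := by
  have hint : ∀ i s, ∫⁻ t, min (ENNReal.ofReal t) 1 ∂(W i s) =
      ∫⁻ x, min (ENNReal.ofReal (x / a s i)) 1 ∂(L s) := fun i s => by
    rw [hW, lintegral_map (by fun_prop) (by fun_prop)]
  have hnn : ∀ s i, 0 ≤ 1 - cdf (L s) (a s i) := fun s i => one_sub_cdf_nonneg _
  have hm : ∀ i, ENNReal.ofReal (meanTail p q L a i) =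
      ENNReal.ofReal (p i) * ENNReal.ofReal (1 - cdf (L Dir.right) (a Dir.right i)) +
      ENNReal.ofReal (q i) * ENNReal.ofReal (1 - cdf (L Dir.left) (a Dir.left i)) := fun i => by
    rw [meanTail_eq hpq, ENNReal.ofReal_add (mul_nonneg (hp i).le (hnn _ i))
      (mul_nonneg (hq i) (hnn _ i)), ENNReal.ofReal_mul (hp i).le, ENNReal.ofReal_mul (hq i)]
  constructor
  · intro i
    rw [hm, stepMean, hint, hint]
    gcongr <;> exact tail_le_lintegral_min (ha0 _ i)
  · choose C hC using fun s => exists_lintegral_min_le (hα1 s) (hreg s)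
    set K := max (max (C Dir.right) (C Dir.left)) 0
    have hK : ∀ s, C s ≤ K := by
      rintro (_ | _)
      · exact (le_max_left _ _).trans (le_max_left _ _)
      · exact (le_max_right _ _).trans (le_max_left _ _)
    refine ⟨K, fun i => ?_⟩
    have hb : ∀ s, ∫⁻ t, min (ENNReal.ofReal t) 1 ∂(W i s) ≤
        ENNReal.ofReal K * ENNReal.ofReal (1 - cdf (L s) (a s i)) := fun s => by
      rw [hint, ← ENNReal.ofReal_mul (le_max_right _ _)]
      exact hC s K (hK s) _ (ha0 s i)
    rw [hm, stepMean, mul_add, mul_left_comm, mul_left_comm (ENNReal.ofReal K)]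
    gcongr <;> exact hb _

theorem mainTheorem3
    (p q : ℕ → ℝ) (hp0 : p 0 = 1) (hq0 : q 0 = 0)
    (hp : ∀ i, 1 ≤ i → 0 < p i) (hq : ∀ i, 1 ≤ i → 0 < q i) (hpq : ∀ i, 1 ≤ i → p i + q i = 1)
    -- the distributions of `τ⁺`, `τ⁻`, concentrated on `(0, ∞)`
    (L : Dir → Measure ℝ) (hLprob : ∀ s, IsProbabilityMeasure (L s))
    (hLpos : ∀ s, L s (Set.Iic 0) = 0)
    (α : Dir → ℝ) (hα0 : ∀ s, 0 < α s) (hα1 : ∀ s, α s < 1)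
    (hreg : ∀ s, RegularlyVarying (fun x => 1 - cdf (L s) x) (-α s))
    (a : Dir → ℕ → ℝ) (ha0 : ∀ s i, 0 < a s i) (ha : ∀ s, Tendsto (a s) atTop atTop)
    -- `W i s` is the distribution of `τ^s / a^s_i`
    (W : ℕ → Dir → Measure ℝ) (hW : ∀ i s, W i s = (L s).map (fun x => x / a s i)) :
    -- explosion, for every initial distribution
    (∀ (Ω : Type*) [MeasurableSpace Ω] (μ : Measure Ω) [IsProbabilityMeasure μ]
        (D : WalkData Ω), D.IsWalk p q W μ →
      (μ {ω | D.Explodes ω} = 1 ↔ explosionSeries p q L a < ⊤) ∧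
      (μ {ω | D.Explodes ω} = 0 ↔ explosionSeries p q L a = ⊤)) ∧
    -- implosion in the sense `lim_{C → ∞} sup_i P_i (σ_0 > C) = 0`
    (∀ (Ω : ℕ → Type*) [∀ i, MeasurableSpace (Ω i)] (P : ∀ i, Measure (Ω i))
        [∀ i, IsProbabilityMeasure (P i)] (D : ∀ i, WalkData (Ω i)),
      (∀ i, (D i).IsWalkFrom p q W (P i) i) →
      (Tendsto (fun C : ℝ => ⨆ i, P i {ω | ENNReal.ofReal C < (D i).hitTime 0 ω}) atTop (𝓝 0) ↔
        implosionSeries p q L a < ⊤ ∧ deltaSeries p q = ⊤)) ∧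
    -- implosion in the sense `ρ_∞ < ∞`, for independent walks `Y_n` with `Y_n(0) = n`
    (∀ (Ω : Type*) [MeasurableSpace Ω] (μ : Measure Ω) [IsProbabilityMeasure μ]
        (Y : ℕ → WalkData Ω), (∀ n, (Y n).IsWalkFrom p q W μ n) →
      iIndepFun (fun (n : ℕ) (ω : Ω) (t : ℝ≥0) => (Y n).walk t ω) μ →
      (μ {ω | implosionTime Y ω < ⊤} = 1 ↔
        implosionSeries p q L a < ⊤ ∧ deltaSeries p q = ⊤) ∧
      (μ {ω | implosionTime Y ω < ⊤} = 0 ↔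
        implosionSeries p q L a = ⊤ ∨ deltaSeries p q < ⊤)) := by
  have hp' : ∀ i, 0 < p i := by
    rintro (_ | i)
    · rw [hp0]; exact one_pos
    · exact hp _ (by omega)
  have hq' : ∀ i, 0 ≤ q i := by
    rintro (_ | i)
    · exact hq0.ge
    · exact (hq _ (by omega)).le
  have hpq' : ∀ i, p i + q i = 1 := by
    rintro (_ | i)
    · rw [hp0, hq0, add_zero]
    · exact hpq _ (by omega)
  have hWp : ∀ i s, IsProbabilityMeasure (W i s) := fun i s => by
    rw [hW]; exact Measure.isProbabilityMeasure_map (by fun_prop)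
  set c := stepMean p q W (fun t => min (ENNReal.ofReal t) 1) with hc
  set m : ℕ → ℝ≥0∞ := fun i => ENNReal.ofReal (meanTail p q L a i) with hmdef
  obtain ⟨hmc, K, hcm⟩ := exists_stepMean_le hp' hq' hpq' hLprob hα1 hreg ha0 hW
  have htpos : ∀ s i, 0 < 1 - cdf (L s) (a s i) := fun s i => one_sub_cdf_pos (hreg s) _
  have hmpos : ∀ i, 0 < meanTail p q L a i := fun i => by
    rw [meanTail_eq hpq']
    exact add_pos_of_pos_of_nonneg (mul_pos (hp' i) (htpos _ i))
      (mul_nonneg (hq' i) (htpos _ i).le)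
  have hc0 : ∀ i, c i ≠ 0 := fun i =>
    ((ENNReal.ofReal_pos.2 (hmpos i)).trans_le (hmc i)).ne'
  choose f hf0 hf hfL using fun s i => exists_laplace (hLpos s) (ha0 s i)
  have hγ : 0 < 1 - Real.exp (-1) := by
    rw [sub_pos, ← Real.exp_zero]; exact Real.exp_lt_exp.2 (by norm_num)
  have hfW : ∀ i s, ENNReal.ofReal (f s i) = ∫⁻ t, ENNReal.ofReal (Real.exp (-t)) ∂(W i s) :=
    fun i s => by rw [hfL, hW, lintegral_map (by fun_prop) (by fun_prop)]
  have hmt : m = fun i => ENNReal.ofReal (p i * (1 - cdf (L Dir.right) (a Dir.right i)) +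
      q i * (1 - cdf (L Dir.left) (a Dir.left i))) := by
    funext i; exact congrArg ENNReal.ofReal (meanTail_eq hpq' L a i)
  have hIc : implosionSeries p q L a < ⊤ → ∑' k, downMean p q c k ≠ ⊤ := by
    intro h
    refine ne_top_of_le_ne_top ?_ (ENNReal.tsum_le_tsum fun k => downMean_mono hcm k)
    simp_rw [downMean_const_mul]
    rw [ENNReal.tsum_mul_left]
    rw [implosionSeries_eq] at h
    exact ENNReal.mul_ne_top ENNReal.ofReal_ne_top h.ne
  have hIu : ¬(implosionSeries p q L a < ⊤ ∧ deltaSeries p q = ⊤) →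
      ∃ u : ℕ → ℝ≥0∞, (∀ i, u i ≠ 0) ∧ Tendsto u atTop (𝓝 0) ∧
      ∀ i, 1 ≤ i → ENNReal.ofReal (p i) *
      ((∫⁻ t, ENNReal.ofReal (Real.exp (-t)) ∂(W i Dir.right)) * u (i + 1)) +
      ENNReal.ofReal (q i) * ((∫⁻ t, ENNReal.ofReal (Real.exp (-t)) ∂(W i Dir.left)) * u (i - 1))
        ≤ u i := by
    intro h
    simp only [← hfW]
    refine exists_superharmonic_tendsto_zero hp' hq hpq' hγ hf0 (fun s i => (htpos s i).le) hf ?_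
    rw [← hmt, ← implosionSeries_eq]
    by_cases hI : implosionSeries p q L a < ⊤
    · exact Or.inr (lt_top_iff_ne_top.2 fun hδ => h ⟨hI, hδ⟩)
    · exact Or.inl (not_lt_top_iff.1 hI)
  refine ⟨?_, ?_, ?_⟩
  · intro Ω _ μ _ D hD
    rw [← not_lt_top_iff]
    refine measure_dichotomy (fun hE => ?_) (fun hE => ?_)
    · rw [explosionSeries_eq] at hE
      -- The superharmonic function is a tail sum, so the full series bounds it uniformly and the
      -- initial law is immaterial.
      refine hD.ae_explodes hWp hq0 (fun i => ∑' n, upMean p q c (i + n))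
        (M := ∑' n, upMean p q c n) ?_ (fun i => ?_) hc0
        (upMean_superharmonic hp' hq0 hq hpq' c)
      · refine ne_top_of_le_ne_top ?_ (ENNReal.tsum_le_tsum fun k => upMean_mono hcm k)
        simp_rw [upMean_const_mul]
        rw [ENNReal.tsum_mul_left]
        exact ENNReal.mul_ne_top ENNReal.ofReal_ne_top hE.ne
      · exact ENNReal.tsum_comp_le_tsum_of_injective (add_right_injective i) _
    · rw [not_lt_top_iff, explosionSeries_eq] at hE
      obtain ⟨u, hu0, hut, hlim, hu⟩ := exists_superharmonic_tendsto_top hp' hq0 hq hpq' hγ hf0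
        (fun s i => (htpos s i).le) hf (by rw [← hmt]; exact hE)
      simp only [hfW] at hu
      exact hD.ae_not_explodes hq0 u hu0 hut hlim hu
  · intro Ω _ P _ D hD
    refine ⟨fun h => ?_, fun h => ?_⟩
    · by_contra hcon
      obtain ⟨u, hu0, hlim, hu⟩ := hIu hcon
      exact not_tendsto_iSup_hitTime hq0 hu0 hlim hu P D hD h
    · exact tendsto_iSup_hitTime hWp hp' hq0 hq hpq' hc0 (hIc h.1) h.2 P D hD
  · intro Ω _ μ _ Y hY hind
    have e : (implosionSeries p q L a = ⊤ ∨ deltaSeries p q < ⊤) ↔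
        ¬(implosionSeries p q L a < ⊤ ∧ deltaSeries p q = ⊤) := by
      rw [not_and_or, not_lt_top_iff, lt_top_iff_ne_top]
    rw [e]
    refine measure_dichotomy (fun h => ?_) (fun h => ?_)
    · exact ae_implosionTime_lt_top hWp hp' hq0 hq hpq' hc0 (hIc h.1) h.2 Y hY
    · obtain ⟨u, hu0, hlim, hu⟩ := hIu h
      exact ae_implosionTime_eq_top hq0 hu0 hlim hu Y hY hind
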